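/- All graphs are finite and simple. For an edge $e$ of a graph $G$, $N[e]$ denotes the set consisting of $e$ and all edges of $G$ sharing an end with $e$. An edge-identifying code of $G$ is a set $\mathcal C\subseteq E(G)$ such that $N[e]\cap\mathcal C\neq\emptyset$ for every $e\in E(G)$ and $N[e]\cap\mathcal C\neq N[f]\cap\mathcal C$ for all distinct $e,f\in E(G)$; $\gamma^{\mathrm{EID}}(G)$ denotes the smallest size of such a code. A pair of distinct edges $uv,uw$ is pendant if $v,w$ both have degree $1$, or if $v,w$ both have degree $2$ and are adjacent; $G$ is pendant-free if it has no pendant pair of edges. The graph induced by $\mathcal C$ has the ends of the edges in $\mathcal C$ as its vertices and $\mathcal C$ as its edge set, and $P_n$ is the path on $n$ vertices. Put $$b(k)=\begin{cases}\binom{\frac43k}{2} & \text{if } k\equiv 0 \pmod 3,\\[2pt] \binom{\frac43(k-1)+1}{2}+1 & \text{if } k\equiv 1 \pmod 3,\\[2pt] \binom{\frac43(k-2)+2}{2}+2 & \text{if } k\equiv 2 \pmod 3.\end{cases}$$ **Theorem.** (i) Let $G$ be a pendant-free graph and let $\mathcal C$ be an edge-identifying code of $G$ with $|\mathcal C|=k$.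 Then $|E(G)|\le b(k)$. (ii) If moreover $k\ge 4$ and $|E(G)|=b(k)$, then all but at most two connected components of the graph induced by $\mathcal C$ are isomorphic to $P_4$. More precisely: if $k\equiv 0\pmod 3$, every component is isomorphic to $P_4$; if $k\equiv 1\pmod 3$, exactly one component is not isomorphic to $P_4$, and it is isomorphic to $P_2$ or $P_5$; if $k\equiv 2\pmod 3$, either exactly one component is not isomorphic to $P_4$, and it is isomorphic to $P_6$, or exactly two components are not isomorphic to $P_4$, and each of them is isomorphic to $P_2$ or $P_5$. (iii) The bound is tight: for every $k\ge 1$ there is a connected pendant-free graph $G$ that has an edge-identifying code of size $k=\gamma^{\mathrm{EID}}(G)$ and satisfies $|E(G)|=b(k)$. -/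

import Mathlib

namespace EdgeCode

variable {V : Type*}

/-- Two distinct edges `uv`, `uw` with the common end `u` form a pendant pair if their non-common
ends `v`, `w` both have degree 1, or both have degree 2 and are connected to each other. -/
def IsPendantPair (G : SimpleGraph V) (u v w : V) : Prop :=
  v ≠ w ∧ G.Adj u v ∧ G.Adj u w ∧
    (((G.neighborSet v).ncard = 1 ∧ (G.neighborSet w).ncard = 1) ∨
      ((G.neighborSet v).ncard = 2 ∧ (G.neighborSet w).ncard = 2 ∧ G.Adj v w))

/-- A graph without pendant pairs of edges. -/
def PendantFree (G : SimpleGraph V) : Prop :=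
  ∀ u v w : V, ¬ IsPendantPair G u v w

/-- The closed neighbourhood `N[e]` of an edge `e` : the edges of `G` adjacent to `e` (sharing an
end with it), together with `e` itself. -/
def closedEdgeNbhd (G : SimpleGraph V) (e : Sym2 V) : Set (Sym2 V) :=
  {f | f ∈ G.edgeSet ∧ (f = e ∨ ∃ v, v ∈ e ∧ v ∈ f)}

/-- Edge-identifying codes: sets of edges that are edge-dominating and edge-separating. -/
structure IsEdgeIdentifyingCode (G : SimpleGraph V) (C : Set (Sym2 V)) : Prop where
  subset_edgeSet : C ⊆ G.edgeSet
  dominating : ∀ e ∈ G.edgeSet, (closedEdgeNbhd G e ∩ C).Nonempty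
  separating : ∀ e ∈ G.edgeSet, ∀ f ∈ G.edgeSet, e ≠ f →
    closedEdgeNbhd G e ∩ C ≠ closedEdgeNbhd G f ∩ C

/-- The edge-identifying code number: the smallest size of an edge-identifying code
(`0` by convention if there is none). -/
noncomputable def edgeIdentifyingCodeNumber (G : SimpleGraph V) : ℕ :=
  sInf {n | ∃ C : Set (Sym2 V), IsEdgeIdentifyingCode G C ∧ C.ncard = n}

/-- The graph induced by a set `S` of edges: its vertices are the ends of the edges in `S`, and its
edges are the elements of `S`. -/
def inducedByEdges (S : Set (Sym2 V)) : SimpleGraph {v : V | ∃ e ∈ S, v ∈ e} :=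
  (SimpleGraph.fromEdgeSet S).induce {v : V | ∃ e ∈ S, v ∈ e}

/-- The connected component `c` is isomorphic to the path `P n` on `n` vertices. -/
def IsPathComponent {H : SimpleGraph V} (c : H.ConnectedComponent) (n : ℕ) : Prop :=
  Nonempty (c.toSimpleGraph ≃g SimpleGraph.pathGraph n)

/-- The components of the graph induced by `S` that are not isomorphic to `P 4`. -/
def exceptionalComponents (S : Set (Sym2 V)) : Set (inducedByEdges S).ConnectedComponent :=
  {c | ¬ IsPathComponent c 4}

/-- The maximal number of edges for a code of size `k`. All divisions by 3 are exact, and no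
subtraction truncates. -/
def edgeBound (k : ℕ) : ℕ :=
  if k % 3 = 0 then (4 * k / 3).choose 2
  else if k % 3 = 1 then (4 * (k - 1) / 3 + 1).choose 2 + 1
  else (4 * (k - 2) / 3 + 2).choose 2 + 2

end EdgeCode

/-!
Let `C` be a code with `k` edges, and call the set of edges of `C` at a vertex its star (if not
empty). The code of an edge `uv` of `G` is the union of the stars of `u` and `v`, so it comes from
an unordered pair, possibly with equal members, of the `M` distinct stars: `G` has at most
`(M + 1).choose 2` edges. Two kinds of pairs are redundant (`exists_redundant_pairs`). If `a` is a
leaf of the graph induced by `C` whose neighbour `b` has degree at least 2, then the pair of the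
stars of `a` and `b` gives the same union as the star of `b` alone; if moreover `b` has degree
exactly 2 (`a` is slender) and `c` is its other neighbour, then the pairs `a, c` and `b, c` give the
same union. With `L` such leaves, `S` of them slender, `|E(G)| ≤ (M + 1).choose 2 - L - S`.

Separation forces that no two leaves have a common neighbour (`IsEdgeIdentifyingCode.noTwinLeaves`).
A degree count then gives `2 * (M - k) ≤ S ≤ L` and `2 * L ≤ M` (`two_mul_card_stars_le`,
`card_properLeaves_le`), whence `3 * M ≤ 4 * k` and `|E(G)| ≤ M.choose 2 + (4 * k - 3 * M)`. For
`4 ≤ k` the right-hand side is largest when `M` is as large as possible, `4 * k - 3 * M = k % 3`,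
and its value is then `edgeBound k` (`le_edgeBound`); values `M < 3` are covered by
`(M + 1).choose 2`.

In case of equality the degree count is sharp, so that the graph induced by `C` has maximum degree at
most 2 (`degree_le_two`) and its components are paths and cycles. The number `4 * k - 3 * M` is a
sum over the components, with contribution `1` of `P 2`, `n - 4` of `P n` for `n ≥ 4`, and `n` of a
cycle of length `n`, while `P 3` has twin leaves (`exists_excess`). As the sum is `k % 3 ≤ 2`, only
`P 4` and the listed exceptions occur.

The bound is attained by `blockGraph (k / 3) (k % 3)`, whose code consists of `k / 3` copies of `P 4`
and `k % 3` single edges. As `edgeBound` is strictly monotone, it has no smaller code.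
-/

namespace EdgeCode

/-! ### Recognizing paths -/

section Path

variable {X : Type*} {T : SimpleGraph X}

theorem exists_adj_dist_eq (hT : T.Connected) {a v : X} {i : ℕ} (h : T.dist a v = i + 1) :
    ∃ u, T.Adj u v ∧ T.dist a u = i := by
  obtain ⟨p, hp⟩ := hT.exists_walk_length_eq_dist v a
  rw [T.dist_comm, h] at hp
  cases p with
  | nil => simp at hp
  | @cons _ w _ hvw q =>
    refine ⟨w, hvw.symm, ?_⟩
    have h1 : T.dist w a ≤ q.length := SimpleGraph.dist_le q
    have h2 := hT.dist_triangle (u := a) (v := w) (w := v)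
    have h3 : T.dist w v = 1 := SimpleGraph.dist_eq_one_iff_adj.2 hvw.symm
    rw [T.dist_comm] at h1
    simp only [SimpleGraph.Walk.length_cons] at hp
    omega

/-- In a connected graph of maximum degree at most 2, a vertex is determined by its distance from
a vertex `a` of degree at most 1: each vertex has at most one neighbour further away from `a`. -/
theorem dist_injective (hT : T.Connected) {a : X}
    (hdeg : ∀ v x y z, T.Adj v x → T.Adj v y → T.Adj v z → x = y ∨ x = z ∨ y = z)
    (ha : ∀ x y, T.Adj a x → T.Adj a y → x = y) : Function.Injective (T.dist a) := by
  have key : ∀ i u v, T.dist a u = i → T.dist a v = i → u = v := by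
    intro i
    induction i with
    | zero =>
      intro u v hu hv
      rw [hT.dist_eq_zero_iff] at hu hv
      exact hu.symm.trans hv
    | succ i ih =>
      intro u v hu hv
      obtain ⟨u', hu', hui⟩ := exists_adj_dist_eq hT hu
      obtain ⟨v', hv', hvi⟩ := exists_adj_dist_eq hT hv
      obtain rfl := ih _ _ hui hvi
      cases i with
      | zero =>
        rw [hT.dist_eq_zero_iff] at hui
        subst hui
        exact ha _ _ hu' hv'
      | succ j =>
        obtain ⟨w, hw, hwj⟩ := exists_adj_dist_eq hT hui
        rcases hdeg u' w u v hw.symm hu' hv' with rfl | rfl | h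
        · omega
        · omega
        · exact h
  exact fun u v h => key _ u v h rfl

/-- A finite connected graph of maximum degree at most 2 with a vertex of degree at most 1 is a
path: the distance from that vertex is an isomorphism. -/
theorem nonempty_iso_pathGraph [Fintype X] (hT : T.Connected) {a : X}
    (hdeg : ∀ v x y z, T.Adj v x → T.Adj v y → T.Adj v z → x = y ∨ x = z ∨ y = z)
    (ha : ∀ x y, T.Adj a x → T.Adj a y → x = y) :
    Nonempty (T ≃g SimpleGraph.pathGraph (Fintype.card X)) := by
  classical
  have hinj := dist_injective hT hdeg ha
  have hdown : ∀ i v, T.dist a v = i → ∀ j ≤ i, ∃ u, T.dist a u = j := by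
    intro i
    induction i with
    | zero => exact fun v hv j hj => ⟨v, by omega⟩
    | succ i ih =>
      intro v hv j hj
      rcases Nat.lt_or_ge i j with h | h
      · exact ⟨v, by omega⟩
      · obtain ⟨u, -, hu⟩ := exists_adj_dist_eq hT hv
        exact ih u hu j h
  have hlt : ∀ v, T.dist a v < Fintype.card X := by
    intro v
    have hsub : Finset.range (T.dist a v + 1) ⊆ Finset.univ.image (T.dist a) := by
      intro j hj
      obtain ⟨u, hu⟩ := hdown _ v rfl j (by simpa [Nat.lt_succ_iff] using hj)
      exact Finset.mem_image.2 ⟨u, Finset.mem_univ _, hu⟩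
    have := Finset.card_le_card hsub
    rw [Finset.card_range, Finset.card_image_of_injective _ hinj, Finset.card_univ] at this
    omega
  let f : X → Fin (Fintype.card X) := fun v => ⟨T.dist a v, hlt v⟩
  have hf : Function.Bijective f := by
    rw [Fintype.bijective_iff_injective_and_card]
    refine ⟨fun u v h => hinj (by simpa [f] using h), by simp⟩
  refine ⟨⟨Equiv.ofBijective f hf, ?_⟩⟩
  have hsucc : ∀ u v, T.dist a u + 1 = T.dist a v → T.Adj u v := by
    intro u v h
    obtain ⟨w, hw, hwu⟩ := exists_adj_dist_eq hT h.symm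
    rwa [hinj hwu] at hw
  intro u v
  simp only [Equiv.ofBijective_apply, SimpleGraph.pathGraph_adj, f]
  constructor
  · rintro (h | h)
    · exact hsucc u v h
    · exact (hsucc v u h).symm
  · intro h
    have hne : T.dist a u ≠ T.dist a v := fun h' => h.ne (hinj h')
    have h1 : T.dist u v = 1 := SimpleGraph.dist_eq_one_iff_adj.2 h
    have h2 := hT.dist_triangle (u := a) (v := u) (w := v)
    have h3 := hT.dist_triangle (u := a) (v := v) (w := u)
    rw [T.dist_comm (u := v)] at h3
    omega

end Path

/-! ### Stars and leaves of the graph induced by a code -/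

section Stars

open scoped Classical

variable {V : Type*} [Fintype V] (H : SimpleGraph V)

/-- The leaves of `H` outside the components isomorphic to `P 2`. -/
noncomputable def properLeaves : Finset V :=
  {a | H.degree a = 1 ∧ ∃ b, H.Adj a b ∧ 2 ≤ H.degree b}

/-- The leaves of `H` whose neighbour has degree exactly 2. -/
noncomputable def slenderLeaves : Finset V :=
  {a | H.degree a = 1 ∧ ∃ b, H.Adj a b ∧ H.degree b = 2}

/-- The vertices of the components of `H` isomorphic to `P 2`. -/
noncomputable def isolatedEnds : Finset V :=
  {a | H.degree a = 1 ∧ ∃ b, H.Adj a b ∧ H.degree b = 1}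

/-- The vertices of `H` of degree at least 2. -/
noncomputable def innerVertices : Finset V := {a | 2 ≤ H.degree a}

/-- The distinct nonempty sets of edges of `H` that are the set of all edges at some vertex. Two
vertices have the same star only if they form a component isomorphic to `P 2`. -/
noncomputable def stars : Finset (Finset (Sym2 V)) :=
  (Finset.univ.filter fun v => 0 < H.degree v).image fun v => H.incidenceFinset v

/-- No two leaves have a common neighbour. -/
def NoTwinLeaves : Prop :=
  ∀ a a' b, H.Adj a b → H.Adj a' b → H.degree a = 1 → H.degree a' = 1 → a = a'

variable {H}

theorem eq_of_degree_eq_one {a b c : V} (ha : H.degree a = 1) (hb : H.Adj a b) (hc : H.Adj a c) :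
    b = c :=
  Finset.card_le_one.1 ha.le _ ((H.mem_neighborFinset _ _).2 hb) _
    ((H.mem_neighborFinset _ _).2 hc)

theorem exists_adj_of_degree_pos {v : V} (h : 0 < H.degree v) : ∃ w, H.Adj v w :=
  (H.degree_pos_iff_exists_adj v).1 h

theorem degree_pos_of_adj {v w : V} (h : H.Adj v w) : 0 < H.degree v :=
  (H.degree_pos_iff_exists_adj v).2 ⟨w, h⟩

theorem mem_incidenceFinset_mk {v x y : V} :
    s(x, y) ∈ H.incidenceFinset v ↔ H.Adj x y ∧ (v = x ∨ v = y) := by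
  simp [SimpleGraph.mem_incidenceFinset, SimpleGraph.incidenceSet]

theorem incidenceFinset_eq_singleton {a b : V} (ha : H.degree a = 1) (hb : H.Adj a b) :
    H.incidenceFinset a = {s(a, b)} := by
  refine (Finset.eq_of_subset_of_card_le ?_ ?_).symm
  · simp [hb]
  · simp [ha]

theorem adj_of_incidenceFinset_eq {u v : V} (hne : u ≠ v) (hu : 0 < H.degree u)
    (h : H.incidenceFinset u = H.incidenceFinset v) :
    H.Adj u v ∧ H.degree u = 1 ∧ H.degree v = 1 := by
  have key : ∀ x, H.Adj u x → x = v := by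
    intro x hx
    have : s(u, x) ∈ H.incidenceFinset v := h ▸ mem_incidenceFinset_mk.2 ⟨hx, Or.inl rfl⟩
    rcases (mem_incidenceFinset_mk.1 this).2 with h' | h'
    · exact absurd h'.symm hne
    · exact h'.symm
  obtain ⟨x, hx⟩ := exists_adj_of_degree_pos hu
  have h1 : H.degree u = 1 := by
    refine le_antisymm (Finset.card_le_one.2 ?_) hu
    intro y hy z hz
    rw [key y (by simpa using hy), key z (by simpa using hz)]
  refine ⟨key x hx ▸ hx, h1, ?_⟩
  rw [← H.card_incidenceFinset_eq_degree, ← h, H.card_incidenceFinset_eq_degree, h1]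

theorem filter_degree_pos_eq :
    (Finset.univ.filter fun v => 0 < H.degree v)
      = properLeaves H ∪ innerVertices H ∪ isolatedEnds H := by
  ext v
  simp only [properLeaves, innerVertices, isolatedEnds, Finset.mem_filter, Finset.mem_univ,
    true_and, Finset.mem_union]
  constructor
  · intro hv
    rcases Nat.lt_or_ge (H.degree v) 2 with h | h
    · have h1 : H.degree v = 1 := by omega
      obtain ⟨w, hw⟩ := exists_adj_of_degree_pos hv
      have := degree_pos_of_adj hw.symm
      rcases Nat.lt_or_ge (H.degree w) 2 with h' | h'
      · exact Or.inr ⟨h1, w, hw, by omega⟩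
      · exact Or.inl (Or.inl ⟨h1, w, hw, h'⟩)
    · exact Or.inl (Or.inr h)
  · rintro ((h | h) | h) <;> omega

theorem disjoint_properLeaves_innerVertices : Disjoint (properLeaves H) (innerVertices H) := by
  rw [Finset.disjoint_left]
  simp only [properLeaves, innerVertices, Finset.mem_filter, Finset.mem_univ, true_and]
  intros; omega

theorem disjoint_union_isolatedEnds :
    Disjoint (properLeaves H ∪ innerVertices H) (isolatedEnds H) := by
  rw [Finset.disjoint_left]
  simp only [properLeaves, innerVertices, isolatedEnds, Finset.mem_filter, Finset.mem_univ,
    true_and, Finset.mem_union]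
  rintro a (⟨h, b, hb, hb'⟩ | h) ⟨h1, c, hc, hc'⟩
  · rw [eq_of_degree_eq_one h hb hc] at hb'
    omega
  · omega

theorem two_mul_card_image_isolatedEnds :
    (isolatedEnds H).card = 2 * ((isolatedEnds H).image fun v => H.incidenceFinset v).card := by
  rw [Finset.card_eq_sum_card_image fun v => H.incidenceFinset v, mul_comm, ← smul_eq_mul,
    ← Finset.sum_const]
  refine Finset.sum_congr rfl fun S hS => ?_
  obtain ⟨v, hv, rfl⟩ := Finset.mem_image.1 hS
  simp only [isolatedEnds, Finset.mem_filter, Finset.mem_univ, true_and] at hv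
  obtain ⟨hv, w, hvw, hw⟩ := hv
  rw [Finset.card_eq_two]
  refine ⟨v, w, hvw.ne, ?_⟩
  ext x
  simp only [isolatedEnds, Finset.mem_filter, Finset.mem_univ, true_and, Finset.mem_insert,
    Finset.mem_singleton]
  constructor
  · rintro ⟨⟨hx, -⟩, hxv⟩
    by_cases hne : x = v
    · exact Or.inl hne
    · have := adj_of_incidenceFinset_eq hne (by omega) hxv
      exact Or.inr (eq_of_degree_eq_one hv this.1.symm hvw)
  · rintro (rfl | rfl)
    · exact ⟨⟨hv, w, hvw, hw⟩, rfl⟩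
    · refine ⟨⟨hw, v, hvw.symm, hv⟩, ?_⟩
      rw [incidenceFinset_eq_singleton hw hvw.symm, incidenceFinset_eq_singleton hv hvw,
        Sym2.eq_swap]

theorem two_mul_card_stars :
    2 * (stars H).card
      = 2 * (properLeaves H).card + 2 * (innerVertices H).card + (isolatedEnds H).card := by
  have hinj : Set.InjOn (fun v => H.incidenceFinset v)
      (properLeaves H ∪ innerVertices H : Finset V) := by
    intro u hu v hv h
    by_contra hne
    have hu' : 0 < H.degree u := by
      have : u ∈ Finset.univ.filter fun v => 0 < H.degree v := by
        rw [filter_degree_pos_eq]; exact Finset.mem_union_left _ hu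
      simpa using this
    obtain ⟨h1, h2, h3⟩ := adj_of_incidenceFinset_eq hne hu' h
    refine Finset.disjoint_left.1 disjoint_union_isolatedEnds hu ?_
    simpa [isolatedEnds, h2] using ⟨v, h1, h3⟩
  have hdisj : Disjoint ((properLeaves H ∪ innerVertices H).image fun v => H.incidenceFinset v)
      ((isolatedEnds H).image fun v => H.incidenceFinset v) := by
    rw [Finset.disjoint_left]
    intro S hS hS'
    obtain ⟨u, hu, rfl⟩ := Finset.mem_image.1 hS
    obtain ⟨v, hv, hvu⟩ := Finset.mem_image.1 hS'
    have hne : v ≠ u := by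
      rintro rfl
      exact Finset.disjoint_left.1 disjoint_union_isolatedEnds hu hv
    have hv' : H.degree v = 1 := by
      simp only [isolatedEnds, Finset.mem_filter] at hv
      exact hv.2.1
    obtain ⟨h1, h2, h3⟩ := adj_of_incidenceFinset_eq hne (by omega) hvu
    refine Finset.disjoint_left.1 disjoint_union_isolatedEnds hu ?_
    simpa [isolatedEnds, h3] using ⟨v, h1.symm, h2⟩
  rw [stars, filter_degree_pos_eq, Finset.image_union, Finset.card_union_of_disjoint hdisj,
    Finset.card_image_of_injOn hinj,
    Finset.card_union_of_disjoint disjoint_properLeaves_innerVertices]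
  have := two_mul_card_image_isolatedEnds (H := H)
  omega

theorem sum_degree_eq :
    2 * H.edgeFinset.card = (properLeaves H).card + (isolatedEnds H).card
      + ∑ v ∈ innerVertices H, H.degree v := by
  have h0 : ∑ v, H.degree v = ∑ v ∈ Finset.univ.filter (fun v => 0 < H.degree v), H.degree v := by
    rw [Finset.sum_filter]
    refine Finset.sum_congr rfl fun v _ => ?_
    split_ifs <;> omega
  rw [← H.sum_degrees_eq_twice_card_edges, h0, filter_degree_pos_eq,
    Finset.sum_union disjoint_union_isolatedEnds,
    Finset.sum_union disjoint_properLeaves_innerVertices]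
  have h1 : ∑ v ∈ properLeaves H, H.degree v = (properLeaves H).card := by
    rw [Finset.card_eq_sum_ones]
    refine Finset.sum_congr rfl fun v hv => ?_
    simp only [properLeaves, Finset.mem_filter] at hv
    exact hv.2.1
  have h2 : ∑ v ∈ isolatedEnds H, H.degree v = (isolatedEnds H).card := by
    rw [Finset.card_eq_sum_ones]
    refine Finset.sum_congr rfl fun v hv => ?_
    simp only [isolatedEnds, Finset.mem_filter] at hv
    exact hv.2.1
  omega

theorem slenderLeaves_subset : slenderLeaves H ⊆ properLeaves H := by
  intro a
  simp only [slenderLeaves, properLeaves, Finset.mem_filter, Finset.mem_univ, true_and]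
  rintro ⟨h, b, hb, hb'⟩
  exact ⟨h, b, hb, hb'.ge⟩

theorem card_properLeaves_le (hH : NoTwinLeaves H) :
    (properLeaves H).card ≤ (innerVertices H).card := by
  have : ∀ a, ∃ b, a ∈ properLeaves H → H.Adj a b ∧ 2 ≤ H.degree b := by
    intro a
    by_cases ha : a ∈ properLeaves H
    · simp only [properLeaves, Finset.mem_filter] at ha
      obtain ⟨b, hb⟩ := ha.2.2
      exact ⟨b, fun _ => hb⟩
    · exact ⟨a, fun h => absurd h ha⟩
  choose β hβ using this
  refine Finset.card_le_card_of_injOn β ?_ ?_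
  · intro a ha
    simpa [innerVertices] using (hβ a ha).2
  · intro a ha a' ha' h
    have h1 : H.degree a = 1 := by
      simp only [properLeaves, Finset.coe_filter] at ha; exact ha.2.1
    have h2 : H.degree a' = 1 := by
      simp only [properLeaves, Finset.coe_filter] at ha'; exact ha'.2.1
    refine hH a a' (β a) (hβ a ha).1 ?_ h1 h2
    rw [show β a = β a' from h]
    exact (hβ a' ha').1

/-- The leaves that are not slender have distinct neighbours, of degree at least 3. -/
theorem card_properLeaves_le_of_degree (hH : NoTwinLeaves H) :
    (properLeaves H).card ≤ (slenderLeaves H).card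
      + ((innerVertices H).filter fun v => 3 ≤ H.degree v).card := by
  have : ∀ a, ∃ b, a ∈ properLeaves H → H.Adj a b ∧ 2 ≤ H.degree b := by
    intro a
    by_cases ha : a ∈ properLeaves H
    · simp only [properLeaves, Finset.mem_filter] at ha
      obtain ⟨b, hb⟩ := ha.2.2
      exact ⟨b, fun _ => hb⟩
    · exact ⟨a, fun h => absurd h ha⟩
  choose β hβ using this
  have hdeg : ∀ a ∈ properLeaves H, H.degree a = 1 := by
    intro a ha
    simp only [properLeaves, Finset.mem_filter] at ha; exact ha.2.1
  rw [← Finset.card_sdiff_add_card_eq_card (slenderLeaves_subset (H := H)), add_comm]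
  refine Nat.add_le_add_left (Finset.card_le_card_of_injOn β ?_ ?_) _
  · intro a ha
    rw [Finset.mem_coe, Finset.mem_sdiff] at ha
    have h2 : H.degree (β a) ≠ 2 := by
      intro h
      refine ha.2 ?_
      simpa [slenderLeaves, hdeg a ha.1] using ⟨β a, (hβ a ha.1).1, h⟩
    have h3 := (hβ a ha.1).2
    simp only [innerVertices, Finset.coe_filter, Finset.mem_filter, Finset.mem_univ, true_and,
      Set.mem_ofPred_eq]
    omega
  · intro a ha a' ha' h
    rw [Finset.mem_coe, Finset.mem_sdiff] at ha ha'
    refine hH a a' (β a) (hβ a ha.1).1 ?_ (hdeg a ha.1) (hdeg a' ha'.1)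
    rw [show β a = β a' from h]
    exact (hβ a' ha'.1).1

theorem sum_degree_innerVertices_ge :
    2 * (innerVertices H).card + ((innerVertices H).filter fun v => 3 ≤ H.degree v).card
      ≤ ∑ v ∈ innerVertices H, H.degree v := by
  rw [Finset.card_filter, mul_comm, ← smul_eq_mul, ← Finset.sum_const, ← Finset.sum_add_distrib]
  refine Finset.sum_le_sum fun v hv => ?_
  have : 2 ≤ H.degree v := by simpa [innerVertices] using hv
  split_ifs <;> omega

/-- The number of slender leaves, a global version of the fact that pruning the leaves of a tree
leaves a tree, which again has two leaves. -/
theorem two_mul_card_stars_le (hH : NoTwinLeaves H) :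
    2 * (stars H).card ≤ 2 * H.edgeFinset.card + (slenderLeaves H).card := by
  have h1 := two_mul_card_stars (H := H)
  have h2 := sum_degree_eq (H := H)
  have h3 := card_properLeaves_le_of_degree hH
  have h4 := sum_degree_innerVertices_ge (H := H)
  omega

theorem degree_le_two
    (h : 2 * (stars H).card = 2 * H.edgeFinset.card + (slenderLeaves H).card)
    (h' : (properLeaves H).card = (slenderLeaves H).card) (v : V) : H.degree v ≤ 2 := by
  by_contra! hv
  have h1 := two_mul_card_stars (H := H)
  have h2 := sum_degree_eq (H := H)
  have h4 := sum_degree_innerVertices_ge (H := H)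
  have h5 : 0 < ((innerVertices H).filter fun v => 3 ≤ H.degree v).card :=
    Finset.card_pos.2 ⟨v, by simp [innerVertices]; omega⟩
  omega

/-! ### Counting the codes of edges -/

/-- The union of an unordered pair of sets of edges. -/
noncomputable def pairUnion : Sym2 (Finset (Sym2 V)) → Finset (Sym2 V) :=
  Sym2.lift ⟨fun S T => S ∪ T, fun S T => Finset.union_comm S T⟩

theorem mem_stars_of_degree_pos {v : V} (h : 0 < H.degree v) : H.incidenceFinset v ∈ stars H :=
  Finset.mem_image_of_mem _ (by simpa using h)

/-- A proper leaf `a` with neighbour `b` makes the pair of the stars of `a` and `b` redundant: it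
has the same union as the star of `b` alone. If `a` is slender and `c` is the second neighbour of
`b`, then moreover the stars of `a` and `c` have the same union as those of `b` and `c`. -/
theorem exists_redundant_pairs (hH : NoTwinLeaves H) :
    ∃ R ⊆ (stars H).sym2, R.card = (properLeaves H).card + (slenderLeaves H).card ∧
      ∀ x ∈ R, ∃ y ∈ (stars H).sym2, y ∉ R ∧ pairUnion y = pairUnion x := by
  have hβ : ∀ a, ∃ b, a ∈ properLeaves H → H.degree a = 1 ∧ H.Adj a b ∧ 2 ≤ H.degree b := by
    intro a
    by_cases ha : a ∈ properLeaves H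
    · simp only [properLeaves, Finset.mem_filter] at ha
      obtain ⟨b, hb⟩ := ha.2.2
      exact ⟨b, fun _ => ⟨ha.2.1, hb⟩⟩
    · exact ⟨a, fun h => absurd h ha⟩
  choose β hβ using hβ
  have hγ : ∀ a, ∃ c, a ∈ slenderLeaves H → H.Adj (β a) c ∧ 2 ≤ H.degree c ∧
      ∀ x, H.Adj (β a) x → x = a ∨ x = c := by
    intro a
    by_cases ha : a ∈ slenderLeaves H
    · obtain ⟨ha1, hab, hb⟩ := hβ a (slenderLeaves_subset ha)
      simp only [slenderLeaves, Finset.mem_filter] at ha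
      obtain ⟨-, -, b, hab', hb'⟩ := ha
      obtain rfl := eq_of_degree_eq_one ha1 hab hab'
      obtain ⟨x, y, hxy, hN⟩ := Finset.card_eq_two.1 hb'
      have hmem : ∀ z, H.Adj (β a) z ↔ z = x ∨ z = y := by
        intro z
        rw [← SimpleGraph.mem_neighborFinset, hN]
        simp
      have hc : ∃ c, H.Adj (β a) c ∧ c ≠ a ∧ ∀ z, H.Adj (β a) z → z = a ∨ z = c := by
        rcases (hmem a).1 hab.symm with rfl | rfl
        · exact ⟨y, (hmem y).2 (Or.inr rfl), hxy.symm, fun z hz => (hmem z).1 hz⟩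
        · exact ⟨x, (hmem x).2 (Or.inl rfl), hxy, fun z hz => ((hmem z).1 hz).symm⟩
      obtain ⟨c, hc, hca, hall⟩ := hc
      refine ⟨c, fun _ => ⟨hc, ?_, hall⟩⟩
      by_contra! h
      have := degree_pos_of_adj hc.symm
      exact hca (hH c a (β a) hc.symm hab (by omega) ha1)
    · exact ⟨a, fun h => absurd h ha⟩
  choose γ hγ using hγ
  have hcard : ∀ v, (H.incidenceFinset v).card = H.degree v :=
    fun v => H.card_incidenceFinset_eq_degree v
  -- a pair of the stars of a proper leaf and an inner vertex determines both
  have hpair : ∀ a ∈ properLeaves H, ∀ a' ∈ properLeaves H, ∀ x x', 2 ≤ H.degree x →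
      2 ≤ H.degree x' →
      s(H.incidenceFinset a, H.incidenceFinset x) = s(H.incidenceFinset a', H.incidenceFinset x') →
      a = a' ∧ x = x' := by
    intro a ha a' ha' x x' hx hx' h
    have ha1 := (hβ a ha).1
    have ha1' := (hβ a' ha').1
    rcases Sym2.eq_iff.1 h with ⟨h1, h2⟩ | ⟨h1, -⟩
    · constructor
      · by_contra hne
        have hadj := (adj_of_incidenceFinset_eq hne (by omega) h1).1
        have := eq_of_degree_eq_one ha1 hadj (hβ a ha).2.1
        have := (hβ a ha).2.2
        simp_all
      · by_contra hne
        have := (adj_of_incidenceFinset_eq hne (by omega) h2).2.1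
        omega
    · have := congrArg Finset.card h1
      rw [hcard, hcard] at this
      omega
  let r₁ : V → Sym2 (Finset (Sym2 V)) := fun a => s(H.incidenceFinset a, H.incidenceFinset (β a))
  let r₂ : V → Sym2 (Finset (Sym2 V)) := fun a => s(H.incidenceFinset a, H.incidenceFinset (γ a))
  have hsub := slenderLeaves_subset (H := H)
  have hleaf : ∀ x ∈ (properLeaves H).image r₁ ∪ (slenderLeaves H).image r₂,
      ∃ S ∈ x, S.card = 1 := by
    intro x hx
    rcases Finset.mem_union.1 hx with hx | hx
    · obtain ⟨a, ha, rfl⟩ := Finset.mem_image.1 hx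
      exact ⟨_, Sym2.mem_mk_left _ _, (hcard a).trans (hβ a ha).1⟩
    · obtain ⟨a, ha, rfl⟩ := Finset.mem_image.1 hx
      exact ⟨_, Sym2.mem_mk_left _ _, (hcard a).trans (hβ a (hsub ha)).1⟩
  have hinner : ∀ u v, 2 ≤ H.degree u → 2 ≤ H.degree v →
      s(H.incidenceFinset u, H.incidenceFinset v)
        ∉ (properLeaves H).image r₁ ∪ (slenderLeaves H).image r₂ := by
    intro u v hu hv h
    obtain ⟨S, hS, hS1⟩ := hleaf _ h
    rcases Sym2.mem_iff.1 hS with rfl | rfl <;> rw [hcard] at hS1 <;> omega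
  refine ⟨(properLeaves H).image r₁ ∪ (slenderLeaves H).image r₂, ?_, ?_, ?_⟩
  · intro x hx
    rcases Finset.mem_union.1 hx with hx | hx
    · obtain ⟨a, ha, rfl⟩ := Finset.mem_image.1 hx
      obtain ⟨h1, -, h2⟩ := hβ a ha
      exact Finset.mk_mem_sym2_iff.2
        ⟨mem_stars_of_degree_pos (by omega), mem_stars_of_degree_pos (by omega)⟩
    · obtain ⟨a, ha, rfl⟩ := Finset.mem_image.1 hx
      have h1 := (hβ a (hsub ha)).1
      have h2 := (hγ a ha).2.1
      exact Finset.mk_mem_sym2_iff.2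
        ⟨mem_stars_of_degree_pos (by omega), mem_stars_of_degree_pos (by omega)⟩
  · rw [Finset.card_union_of_disjoint, Finset.card_image_of_injOn, Finset.card_image_of_injOn]
    · intro a ha a' ha' h
      exact (hpair a (hsub ha) a' (hsub ha') _ _ (hγ a ha).2.1 (hγ a' ha').2.1 h).1
    · intro a ha a' ha' h
      exact (hpair a ha a' ha' _ _ (hβ a ha).2.2 (hβ a' ha').2.2 h).1
    · rw [Finset.disjoint_left]
      intro x hx hx'
      obtain ⟨a, ha, rfl⟩ := Finset.mem_image.1 hx
      obtain ⟨a', ha', h⟩ := Finset.mem_image.1 hx'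
      obtain ⟨rfl, h'⟩ := hpair a' (hsub ha') a ha _ _ (hγ a' ha').2.1 (hβ a ha).2.2 h
      exact (hγ a' ha').1.ne h'.symm
  · intro x hx
    rcases Finset.mem_union.1 hx with hx | hx
    · obtain ⟨a, ha, rfl⟩ := Finset.mem_image.1 hx
      obtain ⟨h1, h2, h3⟩ := hβ a ha
      refine ⟨s(H.incidenceFinset (β a), H.incidenceFinset (β a)), ?_, hinner _ _ h3 h3, ?_⟩
      · exact Finset.mk_mem_sym2_iff.2
          ⟨mem_stars_of_degree_pos (by omega), mem_stars_of_degree_pos (by omega)⟩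
      · simp only [r₁, pairUnion, Sym2.lift_mk, Finset.union_self]
        rw [incidenceFinset_eq_singleton h1 h2, Finset.right_eq_union, Finset.singleton_subset_iff,
          mem_incidenceFinset_mk]
        exact ⟨h2, Or.inr rfl⟩
    · obtain ⟨a, ha, rfl⟩ := Finset.mem_image.1 hx
      obtain ⟨h1, h2, h3⟩ := hβ a (hsub ha)
      obtain ⟨h4, h5, h6⟩ := hγ a ha
      refine ⟨s(H.incidenceFinset (β a), H.incidenceFinset (γ a)), ?_, hinner _ _ h3 h5, ?_⟩
      · exact Finset.mk_mem_sym2_iff.2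
          ⟨mem_stars_of_degree_pos (by omega), mem_stars_of_degree_pos (by omega)⟩
      · simp only [r₂, pairUnion, Sym2.lift_mk]
        apply subset_antisymm
        · refine Finset.union_subset ?_ Finset.subset_union_right
          intro e he
          induction e with | _ x y
          rw [mem_incidenceFinset_mk] at he
          rw [Finset.mem_union, mem_incidenceFinset_mk, mem_incidenceFinset_mk]
          obtain ⟨hxy, rfl | rfl⟩ := he
          · exact (h6 _ hxy).imp (fun h => ⟨hxy, Or.inr h.symm⟩) fun h => ⟨hxy, Or.inr h.symm⟩
          · exact (h6 _ hxy.symm).imp (fun h => ⟨hxy, Or.inl h.symm⟩)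
              fun h => ⟨hxy, Or.inl h.symm⟩
        · refine Finset.union_subset ?_ Finset.subset_union_right
          rw [incidenceFinset_eq_singleton h1 h2, Finset.singleton_subset_iff, Finset.mem_union,
            mem_incidenceFinset_mk]
          exact Or.inl ⟨h2, Or.inr rfl⟩

theorem card_unions_le (hH : NoTwinLeaves H) (K : Finset (Finset (Sym2 V)))
    (hK : ∀ S ∈ K, ∃ u v, 0 < H.degree u ∧ 0 < H.degree v ∧
      S = H.incidenceFinset u ∪ H.incidenceFinset v) :
    K.card + (properLeaves H).card + (slenderLeaves H).card ≤ ((stars H).card + 1).choose 2 := by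
  obtain ⟨R, hR, hRcard, hRred⟩ := exists_redundant_pairs hH
  have hsub : K ⊆ ((stars H).sym2 \ R).image pairUnion := by
    intro S hS
    obtain ⟨u, v, hu, hv, rfl⟩ := hK S hS
    have hmem : s(H.incidenceFinset u, H.incidenceFinset v) ∈ (stars H).sym2 :=
      Finset.mk_mem_sym2_iff.2 ⟨mem_stars_of_degree_pos hu, mem_stars_of_degree_pos hv⟩
    rw [Finset.mem_image]
    by_cases hx : s(H.incidenceFinset u, H.incidenceFinset v) ∈ R
    · obtain ⟨y, hy, hyR, hyx⟩ := hRred _ hx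
      exact ⟨y, Finset.mem_sdiff.2 ⟨hy, hyR⟩, hyx⟩
    · exact ⟨_, Finset.mem_sdiff.2 ⟨hmem, hx⟩, rfl⟩
  have h1 := (Finset.card_le_card hsub).trans Finset.card_image_le
  have h2 := Finset.card_sdiff_add_card_eq_card hR
  rw [Finset.card_sym2] at h2
  omega

end Stars

/-! ### The numerical bound -/

section Numerics

theorem choose_two_succ (n : ℕ) : (n + 1).choose 2 = n.choose 2 + n := by
  rw [Nat.choose_succ_succ' n 1, Nat.choose_one_right, add_comm]

theorem edgeBound_eq (q r : ℕ) (hr : r < 3) :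
    edgeBound (3 * q + r) = (4 * q + r).choose 2 + r := by
  have h1 : (3 * q + r) % 3 = r := by omega
  have h2 : r = 0 ∨ r = 1 ∨ r = 2 := by omega
  rw [edgeBound, h1]
  rcases h2 with rfl | rfl | rfl
  · rw [if_pos rfl, show 4 * (3 * q + 0) / 3 = 4 * q + 0 by omega, add_zero, add_zero]
  · rw [if_neg (by omega), if_pos rfl, show 4 * (3 * q + 1 - 1) / 3 = 4 * q by omega]
  · rw [if_neg (by omega), if_neg (by omega), show 4 * (3 * q + 2 - 2) / 3 = 4 * q by omega]

theorem edgeBound_strictMono : StrictMono edgeBound := by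
  refine strictMono_nat_of_lt_succ fun k => ?_
  obtain ⟨q, r, hr, rfl⟩ : ∃ q r, r < 3 ∧ k = 3 * q + r :=
    ⟨k / 3, k % 3, Nat.mod_lt _ (by norm_num), (Nat.div_add_mod k 3).symm⟩
  rw [edgeBound_eq q r hr]
  rcases Nat.lt_or_ge r 2 with h | h
  · rw [show 3 * q + r + 1 = 3 * q + (r + 1) by ring, edgeBound_eq q (r + 1) (by omega),
      ← add_assoc (4 * q), choose_two_succ]
    omega
  · obtain rfl : r = 2 := by omega
    rw [show 3 * q + 2 + 1 = 3 * (q + 1) + 0 by ring, edgeBound_eq (q + 1) 0 (by omega),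
      show 4 * (q + 1) + 0 = 4 * q + 2 + 1 + 1 by ring, choose_two_succ (4 * q + 2 + 1),
      choose_two_succ (4 * q + 2)]
    omega

/-- The function `M ↦ M.choose 2 - 3 * M` is monotone for `3 ≤ M`, strictly for `4 ≤ M`. -/
theorem choose_two_add_le {M N : ℕ} (hM : 3 ≤ M) (hMN : M < N) :
    M.choose 2 + 3 * (N - M) ≤ N.choose 2 ∧
      (5 ≤ N → M.choose 2 + 3 * (N - M) < N.choose 2) := by
  induction N, hMN using Nat.le_induction with
  | base => rw [choose_two_succ]; omega
  | succ N hN ih => rw [choose_two_succ]; omega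

/-- Here `M` is the number of distinct stars, `L` that of proper leaves and `S` that of slender
leaves of the graph induced by a code of size `k`, and `E` is the number of edges. -/
theorem le_edgeBound {E k M L S : ℕ} (h1 : E + L + S ≤ (M + 1).choose 2)
    (h2 : 2 * M ≤ 2 * k + S) (h3 : S ≤ L) (h4 : 2 * L ≤ M) :
    E ≤ edgeBound k ∧
      (4 ≤ k → E = edgeBound k → 2 * M = 2 * k + S ∧ L = S ∧ 4 * k = 3 * M + k % 3) := by
  obtain ⟨q, r, hr, rfl⟩ : ∃ q r, r < 3 ∧ k = 3 * q + r :=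
    ⟨k / 3, k % 3, Nat.mod_lt _ (by norm_num), (Nat.div_add_mod k 3).symm⟩
  rw [edgeBound_eq q r hr]
  have hmod : (3 * q + r) % 3 = r := by omega
  rw [hmod]
  rw [choose_two_succ] at h1
  have hle : M ≤ 4 * q + r := by omega
  rcases hle.eq_or_lt with rfl | hlt
  · omega
  rcases Nat.lt_or_ge M 3 with hM | hM
  · have hM' : M.choose 2 + M ≤ 3 := by interval_cases M <;> decide
    have h5 : ((4 * q + r) - 1 + 1).choose 2 = _ := choose_two_succ _
    have h6 : 4 * q + r - 1 + 1 = 4 * q + r := by omega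
    rw [h6] at h5
    have h7 : M ≤ (4 * q + r) - 1 := by omega
    have h8 := Nat.choose_le_choose 2 h7
    omega
  · have := choose_two_add_le hM hlt
    omega

end Numerics

/-! ### Codes -/

section Codes

open scoped Classical

variable {V : Type*} {G : SimpleGraph V} {C : Set (Sym2 V)}

/-- The graph with edge set `C` on all vertices; vertices without an edge of `C` are isolated. -/
def codeGraph (C : Set (Sym2 V)) : SimpleGraph V := SimpleGraph.fromEdgeSet C

theorem edgeSet_codeGraph (hC : IsEdgeIdentifyingCode G C) :
    (codeGraph C).edgeSet = C := by
  rw [codeGraph, SimpleGraph.edgeSet_fromEdgeSet]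
  refine Disjoint.sdiff_eq_left (Set.disjoint_left.2 fun e heC he => ?_)
  exact G.not_isDiag_of_mem_edgeSet (hC.subset_edgeSet heC) he

theorem mem_closedEdgeNbhd_inter {u v : V} (hC : C ⊆ G.edgeSet) (f : Sym2 V) :
    f ∈ closedEdgeNbhd G s(u, v) ∩ C ↔ f ∈ C ∧ (u ∈ f ∨ v ∈ f) := by
  constructor
  · rintro ⟨⟨-, h⟩, hf⟩
    refine ⟨hf, ?_⟩
    rcases h with rfl | ⟨w, hw, hwf⟩
    · exact Or.inl (Sym2.mem_mk_left _ _)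
    · rcases Sym2.mem_iff.1 hw with rfl | rfl
      · exact Or.inl hwf
      · exact Or.inr hwf
  · rintro ⟨hf, h⟩
    refine ⟨⟨hC hf, Or.inr ?_⟩, hf⟩
    rcases h with h | h
    · exact ⟨u, Sym2.mem_mk_left _ _, h⟩
    · exact ⟨v, Sym2.mem_mk_right _ _, h⟩

/-- A graph with an edge-identifying code has no pendant pair: the two edges of such a pair have
the same closed neighbourhood. -/
theorem IsEdgeIdentifyingCode.pendantFree (hC : IsEdgeIdentifyingCode G C) : PendantFree G := by
  rintro u v w ⟨hvw, huv, huw, h⟩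
  have hne : s(u, v) ≠ s(u, w) := by
    intro h'
    exact hvw (Sym2.congr_right.1 h')
  refine hC.separating _ huv _ huw hne ?_
  ext f
  rw [mem_closedEdgeNbhd_inter hC.subset_edgeSet, mem_closedEdgeNbhd_inter hC.subset_edgeSet]
  refine and_congr_right fun hf => ?_
  have hf := hC.subset_edgeSet hf
  have one : ∀ x y, G.Adj x y → (G.neighborSet x).ncard = 1 → ∀ z, G.Adj x z → z = y := by
    intro x y hxy hx z hxz
    obtain ⟨t, ht⟩ := Set.ncard_eq_one.1 hx
    have h1 : y ∈ G.neighborSet x := hxy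
    have h2 : z ∈ G.neighborSet x := hxz
    rw [ht] at h1 h2
    exact h2.trans h1.symm
  have two : ∀ x y t, G.Adj x y → G.Adj x t → y ≠ t → (G.neighborSet x).ncard = 2 →
      ∀ z, G.Adj x z → z = y ∨ z = t := by
    intro x y t hxy hxt hyt hx z hxz
    obtain ⟨a, b, -, hab⟩ := Set.ncard_eq_two.1 hx
    have h1 : y ∈ G.neighborSet x := hxy
    have h2 : t ∈ G.neighborSet x := hxt
    have h3 : z ∈ G.neighborSet x := hxz
    rw [hab] at h1 h2 h3
    grind
  have key : ∀ x y, ((G.neighborSet x).ncard = 1 ∧ (G.neighborSet y).ncard = 1 ∨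
      (G.neighborSet x).ncard = 2 ∧ (G.neighborSet y).ncard = 2 ∧ G.Adj x y) →
      G.Adj u x → G.Adj u y → x ∈ f → u ∈ f ∨ y ∈ f := by
    intro x y hxy hux huy hxf
    obtain ⟨z, rfl⟩ := Sym2.mem_iff_exists.1 hxf
    have hxz : G.Adj x z := hf
    rcases hxy with ⟨hx, -⟩ | ⟨hx, -, hadj⟩
    · rw [one x u hux.symm hx z hxz]
      exact Or.inl (Sym2.mem_mk_right _ _)
    · rcases two x u y hux.symm hadj huy.ne hx z hxz with rfl | rfl
      · exact Or.inl (Sym2.mem_mk_right _ _)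
      · exact Or.inr (Sym2.mem_mk_right _ _)
  constructor
  · rintro (h' | h')
    · exact Or.inl h'
    · exact key v w h huv huw h'
  · rintro (h' | h')
    · exact Or.inl h'
    · refine key w v ?_ huw huv h'
      rcases h with h | h
      · exact Or.inl h.symm
      · exact Or.inr ⟨h.2.1, h.1, h.2.2.symm⟩

variable [Fintype V]

theorem closedEdgeNbhd_inter_eq (hC : IsEdgeIdentifyingCode G C) (u v : V) :
    closedEdgeNbhd G s(u, v) ∩ C =
      ↑((codeGraph C).incidenceFinset u
        ∪ (codeGraph C).incidenceFinset v) := by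
  ext f
  rw [mem_closedEdgeNbhd_inter hC.subset_edgeSet]
  simp only [Finset.coe_union, SimpleGraph.coe_incidenceFinset, Set.mem_union,
    SimpleGraph.incidenceSet, edgeSet_codeGraph hC]
  exact and_or_left

/-- The edges from two twin leaves to their common neighbour `b` would have the same code, the star
of `b`. -/
theorem IsEdgeIdentifyingCode.noTwinLeaves (hC : IsEdgeIdentifyingCode G C) :
    NoTwinLeaves (codeGraph C) := by
  intro a a' b hab hab' ha ha'
  by_contra hne
  have hsub : ∀ x, (codeGraph C).Adj x b →
      (codeGraph C).degree x = 1 →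
      (codeGraph C).incidenceFinset x
        ⊆ (codeGraph C).incidenceFinset b := by
    intro x hxb hx
    rw [incidenceFinset_eq_singleton hx hxb, Finset.singleton_subset_iff, mem_incidenceFinset_mk]
    exact ⟨hxb, Or.inr rfl⟩
  have hG : ∀ x, (codeGraph C).Adj x b → s(x, b) ∈ G.edgeSet := fun x hx =>
    hC.subset_edgeSet ((SimpleGraph.fromEdgeSet_adj _).1 hx).1
  refine hC.separating _ (hG a hab) _ (hG a' hab') (fun h => hne (Sym2.congr_left.1 h)) ?_
  rw [closedEdgeNbhd_inter_eq hC, closedEdgeNbhd_inter_eq hC,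
    Finset.union_eq_right.2 (hsub a hab ha), Finset.union_eq_right.2 (hsub a' hab' ha')]

theorem IsEdgeIdentifyingCode.ncard_edgeSet_add_le (hC : IsEdgeIdentifyingCode G C) :
    G.edgeSet.ncard + (properLeaves (codeGraph C)).card
        + (slenderLeaves (codeGraph C)).card
      ≤ ((stars (codeGraph C)).card + 1).choose 2 := by
  have h := card_unions_le hC.noTwinLeaves
    (G.edgeFinset.image fun e => (closedEdgeNbhd G e ∩ C).toFinset) ?_
  · rwa [Finset.card_image_of_injOn, ← Set.ncard_coe_finset, SimpleGraph.coe_edgeFinset] at h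
    intro e he f hf hef
    by_contra hne
    rw [SimpleGraph.coe_edgeFinset] at he hf
    exact hC.separating e he f hf hne (Set.toFinset_inj.1 hef)
  · intro S hS
    obtain ⟨e, he, rfl⟩ := Finset.mem_image.1 hS
    induction e with | _ u v
    rw [SimpleGraph.mem_edgeFinset] at he
    have hne := hC.dominating _ he
    have heq : (closedEdgeNbhd G s(u, v) ∩ C).toFinset =
        (codeGraph C).incidenceFinset u
          ∪ (codeGraph C).incidenceFinset v := by
      rw [← Finset.coe_inj, Set.coe_toFinset, closedEdgeNbhd_inter_eq hC]
    rw [closedEdgeNbhd_inter_eq hC, Finset.coe_nonempty] at hne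
    have hzero : ∀ x, ¬ 0 < (codeGraph C).degree x →
        (codeGraph C).incidenceFinset x = ∅ := by
      intro x hx
      rw [← Finset.card_eq_zero, SimpleGraph.card_incidenceFinset_eq_degree]
      omega
    by_cases hu : 0 < (codeGraph C).degree u
    · by_cases hv : 0 < (codeGraph C).degree v
      · exact ⟨u, v, hu, hv, heq⟩
      · exact ⟨u, u, hu, hu, by rw [heq, hzero v hv, Finset.union_self, Finset.union_empty]⟩
    · by_cases hv : 0 < (codeGraph C).degree v
      · exact ⟨v, v, hv, hv, by rw [heq, hzero u hu, Finset.union_self, Finset.empty_union]⟩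
      · rw [hzero u hu, hzero v hv] at hne
        simp at hne

theorem IsEdgeIdentifyingCode.card_edgeFinset (hC : IsEdgeIdentifyingCode G C) :
    (codeGraph C).edgeFinset.card = C.ncard := by
  rw [← Set.ncard_coe_finset, SimpleGraph.coe_edgeFinset,
    edgeSet_codeGraph hC]

/-- The bound on the number of edges. In the extremal case all vertices have degree at most 2 in
the graph induced by the code, and the number of distinct stars is as large as possible. -/
theorem IsEdgeIdentifyingCode.ncard_edgeSet_le (hC : IsEdgeIdentifyingCode G C) :
    G.edgeSet.ncard ≤ edgeBound C.ncard ∧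
      (4 ≤ C.ncard → G.edgeSet.ncard = edgeBound C.ncard →
        (∀ v, (codeGraph C).degree v ≤ 2) ∧
        4 * C.ncard = 3 * (stars (codeGraph C)).card + C.ncard % 3) := by
  have h1 := hC.ncard_edgeSet_add_le
  have h2 := two_mul_card_stars_le hC.noTwinLeaves
  have h3 := Finset.card_le_card (slenderLeaves_subset (H := codeGraph C))
  have h4 := card_properLeaves_le hC.noTwinLeaves
  have h5 := two_mul_card_stars (H := codeGraph C)
  have h6 := hC.card_edgeFinset
  rw [h6] at h2
  obtain ⟨h7, h8⟩ := le_edgeBound h1 h2 h3 (by omega)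
  refine ⟨h7, fun hk hE => ?_⟩
  obtain ⟨h9, h10, h11⟩ := h8 hk hE
  exact ⟨degree_le_two (by rw [h6]; exact h9) h10, h11⟩

end Codes

/-! ### Components of the graph induced by an extremal code -/

section Components

open scoped Classical

section Connected

variable {X : Type*} [Fintype X] {T : SimpleGraph X}

theorem eq_or_eq_of_connected (hT : T.Connected) {v b : X} (hvb : T.Adj v b)
    (hv : T.degree v = 1) (hb : T.degree b = 1) (w : X) : w = v ∨ w = b := by
  have h := (SimpleGraph.reachable_iff_reflTransGen v w).1 (hT.preconnected v w)
  induction h with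
  | refl => exact Or.inl rfl
  | tail _ hxy ih =>
    rcases ih with rfl | rfl
    · exact Or.inr (eq_of_degree_eq_one hv hxy hvb)
    · exact Or.inl (eq_of_degree_eq_one hb hxy hvb.symm)

theorem isolatedEnds_eq_empty (hT : T.Connected) (h : 3 ≤ Fintype.card X) :
    isolatedEnds T = ∅ := by
  rw [Finset.eq_empty_iff_forall_notMem]
  intro v hv
  simp only [isolatedEnds, Finset.mem_filter, Finset.mem_univ, true_and] at hv
  obtain ⟨hv, b, hvb, hb⟩ := hv
  have hsub : (Finset.univ : Finset X) ⊆ {v, b} := by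
    intro w _
    simpa using eq_or_eq_of_connected hT hvb hv hb w
  have := (Finset.card_le_card hsub).trans Finset.card_le_two
  rw [Finset.card_univ] at this
  omega

theorem isolatedEnds_eq_univ (hpos : ∀ v, 0 < T.degree v) (h : Fintype.card X = 2) :
    isolatedEnds T = Finset.univ := by
  have hone : ∀ v, T.degree v = 1 := by
    intro v
    have h1 := T.degree_lt_card_verts v
    have h2 := hpos v
    omega
  ext v
  obtain ⟨w, hw⟩ := exists_adj_of_degree_pos (hpos v)
  simpa [isolatedEnds, hone] using ⟨w, hw⟩

/-- The weight `4 * deg v - 6`, corrected by `3` at the ends of a path with two vertices, sums to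
twice a natural number `y` over a connected graph of maximum degree at most 2 without twin leaves.
This number is `1` for the path on two vertices, `n - 4` for a path on `n ≥ 4` vertices, and `n`
for a cycle on `n` vertices. -/
theorem exists_excess (hT : T.Connected) (hpos : ∀ v, 0 < T.degree v) (hdeg : ∀ v, T.degree v ≤ 2)
    (hleaf : NoTwinLeaves T) :
    ∃ y : ℕ, 4 * ∑ v, T.degree v + 3 * (isolatedEnds T).card = 6 * Fintype.card X + 2 * y ∧
      (y = 0 → Nonempty (T ≃g SimpleGraph.pathGraph 4)) ∧
      (y = 1 → Nonempty (T ≃g SimpleGraph.pathGraph 2) ∨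
        Nonempty (T ≃g SimpleGraph.pathGraph 5)) ∧
      (y = 2 → Nonempty (T ≃g SimpleGraph.pathGraph 6)) := by
  have hsum := T.sum_degrees_eq_twice_card_edges
  by_cases ha : ∃ a, T.degree a = 1
  · obtain ⟨a, ha⟩ := ha
    have hiso : Nonempty (T ≃g SimpleGraph.pathGraph (Fintype.card X)) := by
      refine nonempty_iso_pathGraph hT (a := a) ?_ fun x y hx hy => eq_of_degree_eq_one ha hx hy
      intro v x y z hx hy hz
      by_contra! h
      have : ({x, y, z} : Finset X) ⊆ T.neighborFinset v := by
        intro w hw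
        simp only [Finset.mem_insert, Finset.mem_singleton] at hw
        rw [SimpleGraph.mem_neighborFinset]
        rcases hw with rfl | rfl | rfl <;> assumption
      have h3 := Finset.card_le_card this
      rw [Finset.card_eq_three.2 ⟨x, y, z, h.1, h.2.1, h.2.2, rfl⟩,
        T.card_neighborFinset_eq_degree] at h3
      have := hdeg v
      omega
    have hedges := hT.card_vert_le_card_edgeSet_add_one
    rw [Nat.card_eq_fintype_card, Nat.card_eq_fintype_card, ← SimpleGraph.edgeFinset_card] at hedges
    have hlt : ∑ v, T.degree v < ∑ _v : X, 2 :=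
      Finset.sum_lt_sum (fun v _ => hdeg v) ⟨a, Finset.mem_univ a, by omega⟩
    rw [Finset.sum_const, Finset.card_univ, smul_eq_mul] at hlt
    have hcard := T.degree_lt_card_verts a
    rcases Nat.lt_or_ge 2 (Fintype.card X) with h | h
    · have hends := isolatedEnds_eq_empty hT h
      have hfour : 4 ≤ Fintype.card X := by
        by_contra! h4
        have h1 := sum_degree_eq (H := T)
        have h2 := sum_degree_innerVertices_ge (H := T)
        have h3 := card_properLeaves_le hleaf
        have h5 := congrArg Finset.card (filter_degree_pos_eq (H := T))
        rw [Finset.filter_true_of_mem fun v _ => hpos v,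
          Finset.card_union_of_disjoint disjoint_union_isolatedEnds,
          Finset.card_union_of_disjoint disjoint_properLeaves_innerVertices, Finset.card_univ] at h5
        rw [hends, Finset.card_empty] at h1 h5
        omega
      refine ⟨Fintype.card X - 4, ?_, fun hy => ?_, fun hy => ?_, fun hy => ?_⟩
      · rw [hends, Finset.card_empty]
        omega
      · rwa [show Fintype.card X = 4 by omega] at hiso
      · rw [show Fintype.card X = 5 by omega] at hiso
        exact Or.inr hiso
      · rwa [show Fintype.card X = 6 by omega] at hiso
    · have hcard2 : Fintype.card X = 2 := by omega
      refine ⟨1, ?_, by omega, fun _ => ?_, by omega⟩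
      · rw [isolatedEnds_eq_univ hpos hcard2, Finset.card_univ]
        omega
      · rw [hcard2] at hiso
        exact Or.inl hiso
  · have htwo : ∀ v, T.degree v = 2 := by
      intro v
      have h1 := hpos v
      have h2 := hdeg v
      have h3 : T.degree v ≠ 1 := fun h => ha ⟨v, h⟩
      omega
    obtain ⟨v⟩ := hT.nonempty
    have hcard := T.degree_lt_card_verts v
    rw [htwo v] at hcard
    refine ⟨Fintype.card X, ?_, by omega, by omega, by omega⟩
    rw [isolatedEnds_eq_empty hT hcard, Finset.card_empty, Finset.sum_congr rfl fun v _ => htwo v,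
      Finset.sum_const, Finset.card_univ, smul_eq_mul]
    omega

end Connected

/-! ### Transfer to the components -/

section Transfer

variable {X V : Type*} [Fintype X] [Fintype V] {T : SimpleGraph X} {H : SimpleGraph V} {f : X → V}

theorem degree_of_injective (hf : Function.Injective f)
    (hadj : ∀ x w, H.Adj (f x) w ↔ ∃ y, f y = w ∧ T.Adj x y) (x : X) :
    T.degree x = H.degree (f x) := by
  rw [← T.card_neighborFinset_eq_degree, ← H.card_neighborFinset_eq_degree,
    ← Finset.card_map ⟨f, hf⟩]
  congr 1
  ext w
  simp only [Finset.mem_map, SimpleGraph.mem_neighborFinset, Function.Embedding.coeFn_mk, hadj]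
  exact exists_congr fun y => and_comm

theorem mem_isolatedEnds_of_injective (hf : Function.Injective f)
    (hadj : ∀ x w, H.Adj (f x) w ↔ ∃ y, f y = w ∧ T.Adj x y) (x : X) :
    x ∈ isolatedEnds T ↔ f x ∈ isolatedEnds H := by
  simp only [isolatedEnds, Finset.mem_filter, Finset.mem_univ, true_and, hadj,
    degree_of_injective hf hadj]
  refine and_congr_right fun _ => ?_
  constructor
  · rintro ⟨b, hb, hb'⟩
    exact ⟨_, ⟨b, rfl, hb⟩, hb'⟩
  · rintro ⟨_, ⟨b, rfl, hb⟩, hb'⟩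
    exact ⟨b, hb, hb'⟩

theorem NoTwinLeaves.of_injective (h : NoTwinLeaves H) (hf : Function.Injective f)
    (hadj : ∀ x w, H.Adj (f x) w ↔ ∃ y, f y = w ∧ T.Adj x y) : NoTwinLeaves T := by
  intro a a' b hab hab' ha ha'
  rw [degree_of_injective hf hadj] at ha ha'
  exact hf (h (f a) (f a') (f b) ((hadj _ _).2 ⟨b, rfl, hab⟩) ((hadj _ _).2 ⟨b, rfl, hab'⟩) ha ha')

end Transfer

variable {V : Type*} {C : Set (Sym2 V)}

theorem codeGraph_adj_iff (c : (inducedByEdges C).ConnectedComponent) (x : c) (w : V) :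
    (codeGraph C).Adj x.1.1 w ↔ ∃ y : c, y.1.1 = w ∧ c.toSimpleGraph.Adj x y := by
  constructor
  · intro h
    have hC := ((SimpleGraph.fromEdgeSet_adj C).1 h).1
    let w' : {v : V | ∃ e ∈ C, v ∈ e} := ⟨w, _, hC, Sym2.mem_mk_right _ _⟩
    have hadj : (inducedByEdges C).Adj x.1 w' := h
    have hw' : w' ∈ c := c.mem_supp_of_adj_mem_supp x.2 hadj
    exact ⟨⟨w', hw'⟩, rfl, hadj⟩
  · rintro ⟨y, rfl, hy⟩
    exact hy

variable [Fintype V]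

theorem degree_codeGraph_pos {v : V} (hC : ∀ e ∈ C, ¬ e.IsDiag) :
    0 < (codeGraph C).degree v ↔ ∃ e ∈ C, v ∈ e := by
  rw [SimpleGraph.degree_pos_iff_exists_adj]
  constructor
  · rintro ⟨w, hw⟩
    exact ⟨_, ((SimpleGraph.fromEdgeSet_adj C).1 hw).1, Sym2.mem_mk_left _ _⟩
  · rintro ⟨e, he, hve⟩
    obtain ⟨w, rfl⟩ := Sym2.mem_iff_exists.1 hve
    exact ⟨w, (SimpleGraph.fromEdgeSet_adj C).2 ⟨he, hC _ he⟩⟩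

theorem sum_components (g : V → ℕ) (hC : ∀ e ∈ C, ¬ e.IsDiag) :
    ∑ c : (inducedByEdges C).ConnectedComponent, ∑ x : c, g x.1.1
      = ∑ v ∈ Finset.univ.filter (fun v => 0 < (codeGraph C).degree v), g v := by
  have h1 : ∀ c : (inducedByEdges C).ConnectedComponent, ∑ x : c, g x.1.1 =
      ∑ w ∈ Finset.univ.filter (fun w => (inducedByEdges C).connectedComponentMk w = c), g w.1 := by
    intro c
    refine (Finset.sum_subtype _ (p := fun w => w ∈ c) (fun w => ?_) fun w => g w.1).symm
    simp only [Finset.mem_filter, Finset.mem_univ, true_and]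
    exact SimpleGraph.ConnectedComponent.mem_supp_iff c w |>.symm
  rw [Finset.sum_congr rfl fun c _ => h1 c]
  rw [Finset.sum_fiberwise Finset.univ (inducedByEdges C).connectedComponentMk fun w => g w.1]
  refine (Finset.sum_subtype _ (fun v => ?_) _).symm
  rw [Finset.mem_filter, degree_codeGraph_pos hC]
  simp

end Components

/-! ### The components in the extremal case -/

section Extremal

open scoped Classical

theorem exists_unique_of_sum_eq_one {ι : Type*} {s : Finset ι} {y : ι → ℕ}
    (h : ∑ c ∈ s, y c = 1) : ∃ c ∈ s, y c = 1 ∧ ∀ d ∈ s, d ≠ c → y d = 0 := by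
  obtain ⟨c, hc, hyc⟩ := Finset.exists_ne_zero_of_sum_ne_zero (h.trans_ne one_ne_zero)
  have h1 := Finset.add_sum_erase s y hc
  have h2 : ∑ x ∈ s.erase c, y x = 0 := by omega
  rw [Finset.sum_eq_zero_iff] at h2
  exact ⟨c, hc, by omega, fun d hd hdc => h2 d (Finset.mem_erase.2 ⟨hdc, hd⟩)⟩

theorem exists_of_sum_eq_two {ι : Type*} {s : Finset ι} {y : ι → ℕ} (h : ∑ c ∈ s, y c = 2) :
    (∃ c ∈ s, y c = 2 ∧ ∀ d ∈ s, d ≠ c → y d = 0) ∨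
      ∃ c ∈ s, ∃ d ∈ s, c ≠ d ∧ y c = 1 ∧ y d = 1 ∧ ∀ x ∈ s, x ≠ c → x ≠ d → y x = 0 := by
  obtain ⟨c, hc, hyc⟩ := Finset.exists_ne_zero_of_sum_ne_zero (h.trans_ne two_ne_zero)
  have h1 := Finset.add_sum_erase s y hc
  have h2 : y c = 1 ∨ y c = 2 := by omega
  rcases h2 with h2 | h2
  · obtain ⟨d, hd, hyd, hall⟩ := exists_unique_of_sum_eq_one (s := s.erase c) (y := y) (by omega)
    refine Or.inr ⟨c, hc, d, Finset.mem_of_mem_erase hd, (Finset.ne_of_mem_erase hd).symm, h2, hyd,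
      fun x hx hxc hxd => hall x (Finset.mem_erase.2 ⟨hxc, hx⟩) hxd⟩
  · have h3 : ∑ x ∈ s.erase c, y x = 0 := by omega
    rw [Finset.sum_eq_zero_iff] at h3
    exact Or.inl ⟨c, hc, h2, fun d hd hdc => h3 d (Finset.mem_erase.2 ⟨hdc, hd⟩)⟩

variable {V : Type*} {C : Set (Sym2 V)}

theorem IsPathComponent.eq {H : SimpleGraph V} {c : H.ConnectedComponent} {m n : ℕ}
    (hm : IsPathComponent c m) (hn : IsPathComponent c n) : m = n := by
  obtain ⟨f⟩ := hm
  obtain ⟨g⟩ := hn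
  simpa using Fintype.card_congr (f.symm.trans g).toEquiv

variable [Fintype V] {G : SimpleGraph V}

/-- If the graph induced by a code has maximum degree at most 2, then `4 * C.ncard - 3 * M`, with
`M` the number of distinct stars, is a sum of contributions of the components. -/
theorem exists_component_excess (hC : IsEdgeIdentifyingCode G C)
    (hdeg : ∀ v, (codeGraph C).degree v ≤ 2) :
    ∃ y : (inducedByEdges C).ConnectedComponent → ℕ,
      4 * C.ncard = 3 * (stars (codeGraph C)).card + ∑ c, y c ∧
      (∀ c, y c = 0 → IsPathComponent c 4) ∧
      (∀ c, y c = 1 → IsPathComponent c 2 ∨ IsPathComponent c 5) ∧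
      (∀ c, y c = 2 → IsPathComponent c 6) := by
  have hdiag : ∀ e ∈ C, ¬ e.IsDiag := fun e he =>
    G.not_isDiag_of_mem_edgeSet (hC.subset_edgeSet he)
  have hf : ∀ c : (inducedByEdges C).ConnectedComponent,
      Function.Injective fun x : c => x.1.1 :=
    fun c => Subtype.val_injective.comp Subtype.val_injective
  have hadj := codeGraph_adj_iff (C := C)
  have hdegc := fun c => degree_of_injective (hf c) (hadj c)
  have hex : ∀ c : (inducedByEdges C).ConnectedComponent, ∃ y : ℕ, _ := fun c =>
    exists_excess c.connected_toSimpleGraph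
      (fun x => by
        rw [hdegc c, degree_codeGraph_pos hdiag]
        exact x.1.2)
      (fun x => by
        rw [hdegc c]
        exact hdeg _)
      (hC.noTwinLeaves.of_injective (hf c) (hadj c))
  choose y hy h4 h25 h6 using hex
  refine ⟨y, ?_, h4, h25, h6⟩
  let g : V → ℕ := fun v =>
    4 * (codeGraph C).degree v + 3 * if v ∈ isolatedEnds (codeGraph C) then 1 else 0
  have hg : ∀ c : (inducedByEdges C).ConnectedComponent,
      ∑ x : c, g x.1.1 = 6 * Fintype.card c + 2 * y c := by
    intro c
    rw [← hy c, Finset.sum_add_distrib, ← Finset.mul_sum, ← Finset.mul_sum, Finset.sum_boole]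
    congr 2
    · exact Finset.sum_congr rfl fun x _ => (hdegc c x).symm
    · rw [Nat.cast_id]
      congr 1
      ext x
      rw [Finset.mem_filter, mem_isolatedEnds_of_injective (hf c) (hadj c)]
      simp
  have hsum := sum_components (C := C) g hdiag
  have hone := sum_components (C := C) (fun _ => 1) hdiag
  rw [Finset.sum_congr rfl fun c _ => hg c, Finset.sum_add_distrib, ← Finset.mul_sum,
    ← Finset.mul_sum, Finset.sum_add_distrib, ← Finset.mul_sum, ← Finset.mul_sum,
    Finset.sum_boole, Nat.cast_id] at hsum
  simp only [Finset.sum_const, smul_eq_mul, mul_one, Finset.card_univ] at hone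
  have hW := filter_degree_pos_eq (H := codeGraph C)
  have hends : ((Finset.univ.filter fun v => 0 < (codeGraph C).degree v).filter
      fun v => v ∈ isolatedEnds (codeGraph C)) = isolatedEnds (codeGraph C) := by
    rw [Finset.filter_mem_eq_inter, Finset.inter_eq_right, hW]
    exact Finset.subset_union_right
  have hdegsum : ∑ v ∈ Finset.univ.filter (fun v => 0 < (codeGraph C).degree v),
      (codeGraph C).degree v = 2 * C.ncard := by
    rw [← hC.card_edgeFinset, ← SimpleGraph.sum_degrees_eq_twice_card_edges, Finset.sum_filter]
    refine Finset.sum_congr rfl fun v _ => ?_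
    split_ifs <;> omega
  rw [hends, hdegsum, hone, hW, Finset.card_union_of_disjoint disjoint_union_isolatedEnds,
    Finset.card_union_of_disjoint disjoint_properLeaves_innerVertices] at hsum
  have hstars := two_mul_card_stars (H := codeGraph C)
  omega

theorem IsEdgeIdentifyingCode.exceptionalComponents (hC : IsEdgeIdentifyingCode G C)
    (hk : 4 ≤ C.ncard) (hE : G.edgeSet.ncard = edgeBound C.ncard) :
    (C.ncard % 3 = 0 → EdgeCode.exceptionalComponents C = ∅) ∧
      (C.ncard % 3 = 1 → ∃ c, EdgeCode.exceptionalComponents C = {c} ∧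
        (IsPathComponent c 2 ∨ IsPathComponent c 5)) ∧
      (C.ncard % 3 = 2 →
        (∃ c, EdgeCode.exceptionalComponents C = {c} ∧ IsPathComponent c 6) ∨
        (∃ c d, c ≠ d ∧ EdgeCode.exceptionalComponents C = {c, d} ∧
          (IsPathComponent c 2 ∨ IsPathComponent c 5) ∧
          (IsPathComponent d 2 ∨ IsPathComponent d 5))) := by
  obtain ⟨hdeg, hM⟩ := hC.ncard_edgeSet_le.2 hk hE
  obtain ⟨y, hy, h4, h25, h6⟩ := exists_component_excess hC hdeg
  have hsum : ∑ c, y c = C.ncard % 3 := by omega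
  have hne : ∀ c, y c = 1 ∨ y c = 2 → ¬ IsPathComponent c 4 := by
    rintro c (h | h) hc
    · rcases h25 c h with h' | h' <;> exact absurd (hc.eq h') (by norm_num)
    · exact absurd (hc.eq (h6 c h)) (by norm_num)
  refine ⟨fun h => ?_, fun h => ?_, fun h => ?_⟩
  · rw [h, Finset.sum_eq_zero_iff] at hsum
    exact Set.eq_empty_of_forall_notMem fun c hc => hc (h4 c (hsum c (Finset.mem_univ c)))
  · obtain ⟨c, -, hc, hall⟩ := exists_unique_of_sum_eq_one (hsum.trans h)
    refine ⟨c, ?_, h25 c hc⟩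
    ext d
    refine ⟨fun hd => ?_, ?_⟩
    · by_contra hdc
      exact hd (h4 d (hall d (Finset.mem_univ d) hdc))
    · rintro rfl
      exact hne d (Or.inl hc)
  · rcases exists_of_sum_eq_two (hsum.trans h) with ⟨c, -, hc, hall⟩ |
      ⟨c, -, d, -, hcd, hc, hd, hall⟩
    · refine Or.inl ⟨c, ?_, h6 c hc⟩
      ext d
      refine ⟨fun hd => ?_, ?_⟩
      · by_contra hdc
        exact hd (h4 d (hall d (Finset.mem_univ d) hdc))
      · rintro rfl
        exact hne d (Or.inr hc)
    · refine Or.inr ⟨c, d, hcd, ?_, h25 c hc, h25 d hd⟩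
      ext x
      refine ⟨fun hx => ?_, ?_⟩
      · by_contra hxcd
        rw [Set.mem_insert_iff, Set.mem_singleton_iff, not_or] at hxcd
        exact hx (h4 x (hall x (Finset.mem_univ x) hxcd.1 hxcd.2))
      · rintro (rfl | rfl)
        · exact hne x (Or.inl hc)
        · exact hne x (Or.inl hd)

end Extremal

/-! ### Graphs attaining the bound -/

section Blocks

/-- Adjacency inside a block: a cycle `0 1 2 3 4` with the chord `03` for a large block (`true`),
and the single edge `01` for a small block (`false`), where `2`, `3`, `4` are not vertices. -/
def blockAdj : Bool → Fin 5 → Fin 5 → Bool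
  | true, s, t => t == s + 1 || s == t + 1 || (s == 0 && t == 3) || (s == 3 && t == 0)
  | false, s, t => (s == 0 && t == 1) || (s == 1 && t == 0)

/-- The vertices of a block that are joined to other blocks. -/
def blockCore : Bool → Fin 5 → Bool
  | true, s => s != 4
  | false, s => s == 0

/-- The edges of the code inside a block: the path `0 1 2 3` in a large block, and the edge `01` in
a small one. -/
def blockCode : Bool → Fin 5 → Fin 5 → Bool
  | true, s, t => s != 4 && t != 4 && (t == s + 1 || s == t + 1)
  | false, s, t => (s == 0 && t == 1) || (s == 1 && t == 0)

/-- The actual vertices of a block. -/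
def blockVertex : Bool → Fin 5 → Bool
  | true, _ => true
  | false, s => s == 0 || s == 1

theorem blockAdj_symm : ∀ κ s t, blockAdj κ s t → blockAdj κ t s := by decide

theorem blockAdj_irrefl : ∀ κ s, ¬ blockAdj κ s s := by decide

theorem blockVertex_of_blockAdj : ∀ κ s t, blockAdj κ s t → blockVertex κ t := by decide

theorem blockVertex_of_blockCore : ∀ κ s, blockCore κ s → blockVertex κ s := by decide

theorem blockAdj_of_blockCode : ∀ κ s t, blockCode κ s t → blockAdj κ s t := by decide

theorem exists_blockCode_of_blockCore :
    ∀ κ s, blockCore κ s → ∃ a b, blockCode κ a b ∧ (s = a ∨ s = b) := by decide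

theorem exists_blockCode_of_blockAdj : ∀ κ s t, blockAdj κ s t →
    ∃ a b, blockCode κ a b ∧ ((s = a ∨ s = b) ∨ (t = a ∨ t = b)) := by decide

theorem blockCore_separated : ∀ κ s s', blockCore κ s → blockCore κ s' →
    (∀ a b, blockCode κ a b → ((s = a ∨ s = b) ↔ (s' = a ∨ s' = b))) → s = s' := by decide

set_option maxRecDepth 10000 in
theorem blockAdj_separated : ∀ κ s t, blockAdj κ s t → ∀ s' t', blockAdj κ s' t' →
    (∀ a b, blockCode κ a b →
      (((s = a ∨ s = b) ∨ (t = a ∨ t = b)) ↔ ((s' = a ∨ s' = b) ∨ (t' = a ∨ t' = b)))) →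
    (s = s' ∧ t = t') ∨ (s = t' ∧ t = s') := by decide

theorem exists_chain_of_blockCode_true : ∀ s t, blockCode true s t →
    ∃ m : Fin 3, (s = m.castSucc.castSucc ∧ t = m.succ.castSucc) ∨
      (s = m.succ.castSucc ∧ t = m.castSucc.castSucc) := by decide

theorem eq_of_blockCode_false : ∀ s t, blockCode false s t →
    (s = 0 ∧ t = 1) ∨ (s = 1 ∧ t = 0) := by decide

theorem exists_blockAdj_zero : ∀ κ s, blockVertex κ s →
    s = 0 ∨ blockAdj κ s 0 ∨ (blockAdj κ s 1 ∧ blockAdj κ 1 0) := by decide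

variable {p r : ℕ}

/-- The disjoint union of `p` large and `r` small blocks, with all edges between vertices in the
cores of different blocks added. -/
def blockGraph (p r : ℕ) : SimpleGraph ((Fin p ⊕ Fin r) × Fin 5) where
  Adj x y := if x.1 = y.1 then blockAdj x.1.isLeft x.2 y.2 = true
    else blockCore x.1.isLeft x.2 = true ∧ blockCore y.1.isLeft y.2 = true
  symm := ⟨fun x y h => by
    by_cases hxy : x.1 = y.1
    · rw [if_pos hxy] at h
      rw [if_pos hxy.symm, ← hxy]
      exact blockAdj_symm _ _ _ h
    · rw [if_neg hxy] at h
      rw [if_neg (Ne.symm hxy)]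
      exact h.symm⟩
  loopless := ⟨fun x h => by
    rw [if_pos rfl] at h
    exact blockAdj_irrefl _ _ h⟩

theorem blockGraph_adj_of_eq {x y : (Fin p ⊕ Fin r) × Fin 5} (h : x.1 = y.1) :
    (blockGraph p r).Adj x y ↔ blockAdj x.1.isLeft x.2 y.2 := by
  simp [blockGraph, h]

theorem blockGraph_adj_of_ne {x y : (Fin p ⊕ Fin r) × Fin 5} (h : x.1 ≠ y.1) :
    (blockGraph p r).Adj x y ↔ blockCore x.1.isLeft x.2 ∧ blockCore y.1.isLeft y.2 := by
  simp [blockGraph, h]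

theorem blockVertex_of_adj {x y : (Fin p ⊕ Fin r) × Fin 5} (h : (blockGraph p r).Adj x y) :
    blockVertex y.1.isLeft y.2 := by
  by_cases hxy : x.1 = y.1
  · rw [blockGraph_adj_of_eq hxy] at h
    rw [← hxy]
    exact blockVertex_of_blockAdj _ _ _ h
  · rw [blockGraph_adj_of_ne hxy] at h
    exact blockVertex_of_blockCore _ _ h.2

/-- `x` lies on the edge `ab` of the block `i`. -/
def OnBlockEdge (x : (Fin p ⊕ Fin r) × Fin 5) (i : Fin p ⊕ Fin r) (a b : Fin 5) : Prop :=
  x.1 = i ∧ (x.2 = a ∨ x.2 = b)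

theorem exists_onBlockEdge {x y : (Fin p ⊕ Fin r) × Fin 5} (h : (blockGraph p r).Adj x y) :
    ∃ a b, blockCode x.1.isLeft a b ∧ (OnBlockEdge x x.1 a b ∨ OnBlockEdge y x.1 a b) := by
  by_cases hxy : x.1 = y.1
  · rw [blockGraph_adj_of_eq hxy] at h
    obtain ⟨a, b, hab, h⟩ := exists_blockCode_of_blockAdj _ _ _ h
    exact ⟨a, b, hab, h.imp (fun h => ⟨rfl, h⟩) fun h => ⟨hxy.symm, h⟩⟩
  · rw [blockGraph_adj_of_ne hxy] at h
    obtain ⟨a, b, hab, h⟩ := exists_blockCode_of_blockCore _ _ h.1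
    exact ⟨a, b, hab, Or.inl ⟨rfl, h⟩⟩

/-- The edges of `blockGraph p r` are separated by the code edges that they meet: these determine
the blocks of both ends, and then the ends. -/
theorem blockGraph_separated {x y x' y' : (Fin p ⊕ Fin r) × Fin 5}
    (hxy : (blockGraph p r).Adj x y) (hxy' : (blockGraph p r).Adj x' y')
    (h : ∀ (i : Fin p ⊕ Fin r) (a b : Fin 5), blockCode i.isLeft a b →
      ((OnBlockEdge x i a b ∨ OnBlockEdge y i a b) ↔
        (OnBlockEdge x' i a b ∨ OnBlockEdge y' i a b))) :
    (x = x' ∧ y = y') ∨ (x = y' ∧ y = x') := by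
  have hblock : ∀ u v u' v' : (Fin p ⊕ Fin r) × Fin 5, (blockGraph p r).Adj u v →
      (∀ (i : Fin p ⊕ Fin r) (a b : Fin 5), blockCode i.isLeft a b →
        ((OnBlockEdge u i a b ∨ OnBlockEdge v i a b) →
          (OnBlockEdge u' i a b ∨ OnBlockEdge v' i a b))) → u.1 = u'.1 ∨ u.1 = v'.1 := by
    intro u v u' v' huv h
    obtain ⟨a, b, hab, hon⟩ := exists_onBlockEdge huv
    exact (h _ a b hab hon).imp (fun h => h.1.symm) fun h => h.1.symm
  have h1 := hblock x y x' y' hxy fun i a b hab => (h i a b hab).1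
  have h2 := hblock y x x' y' hxy.symm fun i a b hab h' => (h i a b hab).1 h'.symm
  have h3 := hblock x' y' x y hxy' fun i a b hab => (h i a b hab).2
  have h4 := hblock y' x' x y hxy'.symm fun i a b hab h' => (h i a b hab).2 h'.symm
  -- the case of ends in different blocks, with the blocks matched up
  have hcross : ∀ u v u' v' : (Fin p ⊕ Fin r) × Fin 5, (blockGraph p r).Adj u v →
      (blockGraph p r).Adj u' v' → u.1 ≠ v.1 → u.1 = u'.1 → v.1 = v'.1 →
      (∀ (i : Fin p ⊕ Fin r) (a b : Fin 5), blockCode i.isLeft a b →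
        ((OnBlockEdge u i a b ∨ OnBlockEdge v i a b) ↔
          (OnBlockEdge u' i a b ∨ OnBlockEdge v' i a b))) → u = u' := by
    intro u v u' v' huv huv' hne hu hv h
    rw [blockGraph_adj_of_ne hne] at huv
    rw [blockGraph_adj_of_ne (hu ▸ hv ▸ hne), ← hu] at huv'
    refine Prod.ext hu (blockCore_separated _ _ _ huv.1 huv'.1 fun a b hab => ?_)
    have := h u.1 a b hab
    simpa [OnBlockEdge, ← hu, ← hv, hne.symm] using this
  by_cases he : x.1 = y.1
  · have hx' : x.1 = x'.1 := by
      rcases h3 with h | h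
      · exact h.symm
      · exact he.trans h.symm
    have hy' : x.1 = y'.1 := by
      rcases h4 with h | h
      · exact h.symm
      · exact he.trans h.symm
    rw [blockGraph_adj_of_eq he] at hxy
    rw [blockGraph_adj_of_eq (hx'.symm.trans hy'), ← hx'] at hxy'
    have := blockAdj_separated _ _ _ hxy _ _ hxy' fun a b hab => by
      simpa [OnBlockEdge, ← he, ← hx', ← hy'] using h x.1 a b hab
    refine this.imp (fun h => ⟨Prod.ext hx' h.1, Prod.ext (he.symm.trans hy') h.2⟩)
      fun h => ⟨Prod.ext hy' h.1, Prod.ext (he.symm.trans hx') h.2⟩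
  · rcases h1 with h1 | h1
    · have h5 : y.1 = y'.1 := h2.resolve_left fun h => he (h1.trans h.symm)
      refine Or.inl ⟨hcross x y x' y' hxy hxy' he h1 h5 h,
        hcross y x y' x' hxy.symm hxy'.symm (Ne.symm he) h5 h1 fun i a b hab => ?_⟩
      rw [or_comm, h i a b hab, or_comm]
    · have h5 : y.1 = x'.1 := h2.resolve_right fun h => he (h1.trans h.symm)
      refine Or.inr ⟨hcross x y y' x' hxy hxy'.symm he h1 h5 fun i a b hab => ?_,
        hcross y x x' y' hxy.symm hxy' (Ne.symm he) h5 h1 fun i a b hab => ?_⟩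
      · rw [h i a b hab, or_comm]
      · rw [or_comm, h i a b hab]

theorem two_mul_choose_two (n : ℕ) : 2 * n.choose 2 + n = n * n := by
  induction n with
  | zero => rfl
  | succ n ih => rw [choose_two_succ]; linarith

theorem sum_blockAdj : (∑ s, ∑ t, if blockAdj true s t then 1 else 0) = 12 ∧
    (∑ s, ∑ t, if blockAdj false s t then 1 else 0) = 2 := by decide

theorem sum_blockCore : (∑ s, if blockCore true s then 1 else 0) = 4 ∧
    (∑ s, if blockCore false s then 1 else 0) = 1 := by decide

theorem sum_degree_blockGraph [DecidableRel (blockGraph p r).Adj] :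
    ∑ x, (blockGraph p r).degree x = 2 * ((4 * p + r).choose 2 + r) := by
  let c : Fin p ⊕ Fin r → ℕ := Sum.elim (fun _ => 4) fun _ => 1
  let l : Fin p ⊕ Fin r → ℕ := Sum.elim (fun _ => 12) fun _ => 2
  have hl : ∀ i : Fin p ⊕ Fin r,
      ∑ s, ∑ t, (if blockAdj i.isLeft s t then 1 else 0) = l i := by
    rintro (i | i)
    · exact sum_blockAdj.1
    · exact sum_blockAdj.2
  have hc : ∀ i : Fin p ⊕ Fin r, ∑ s, (if blockCore i.isLeft s then 1 else 0) = c i := by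
    rintro (i | i)
    · exact sum_blockCore.1
    · exact sum_blockCore.2
  have hblock : ∀ i j : Fin p ⊕ Fin r,
      (∑ s, ∑ t, if (blockGraph p r).Adj (i, s) (j, t) then 1 else 0)
        + (if i = j then c i * c j else 0) = c i * c j + if i = j then l i else 0 := by
    intro i j
    by_cases hij : i = j
    · subst hij
      simp only [blockGraph_adj_of_eq, if_true, hl]
      exact add_comm _ _
    · simp only [blockGraph_adj_of_ne (x := (i, _)) (y := (j, _)) hij, if_neg hij, add_zero]
      rw [← hc i, ← hc j, Finset.sum_mul_sum]
      refine Finset.sum_congr rfl fun s _ => Finset.sum_congr rfl fun t _ => ?_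
      by_cases h1 : blockCore i.isLeft s <;> by_cases h2 : blockCore j.isLeft t <;> simp [h1, h2]
  have htotal : ∑ x, (blockGraph p r).degree x
      = ∑ i, ∑ j, ∑ s, ∑ t, if (blockGraph p r).Adj (i, s) (j, t) then 1 else 0 := by
    rw [Fintype.sum_prod_type]
    refine Finset.sum_congr rfl fun i _ => ?_
    rw [Finset.sum_comm]
    refine Finset.sum_congr rfl fun s _ => ?_
    rw [← SimpleGraph.card_neighborFinset_eq_degree, SimpleGraph.neighborFinset_eq_filter,
      Finset.card_filter, Fintype.sum_prod_type]
  have hsum := Finset.sum_congr rfl fun i (_ : i ∈ Finset.univ) =>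
    Finset.sum_congr rfl fun j (_ : j ∈ Finset.univ) => hblock i j
  simp only [Finset.sum_add_distrib, Finset.sum_ite_eq, Finset.mem_univ, if_true] at hsum
  rw [← htotal, ← Finset.sum_mul_sum] at hsum
  simp only [Fintype.sum_sum_type, c, l, Sum.elim_inl, Sum.elim_inr, Finset.sum_const,
    Finset.card_univ, Fintype.card_fin, smul_eq_mul] at hsum
  have := two_mul_choose_two (4 * p + r)
  nlinarith

end Blocks

section Tight

open scoped Classical

variable {p r : ℕ} {X : Type*} {f : X → (Fin p ⊕ Fin r) × Fin 5}

/-- The code edges of all blocks, on a vertex set `X` identified by `f` with the vertices of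
`blockGraph p r`. -/
def blockCodeSet (f : X → (Fin p ⊕ Fin r) × Fin 5) : Set (Sym2 X) :=
  {e | ∃ x y, (f x).1 = (f y).1 ∧ blockCode (f x).1.isLeft (f x).2 (f y).2 ∧ e = s(x, y)}

theorem isEdgeIdentifyingCode_blockCodeSet (hf : Function.Injective f)
    (hrange : ∀ z, (∃ x, f x = z) ↔ blockVertex z.1.isLeft z.2) :
    IsEdgeIdentifyingCode ((blockGraph p r).comap f) (blockCodeSet f) := by
  have hsub : blockCodeSet f ⊆ ((blockGraph p r).comap f).edgeSet := by
    rintro _ ⟨x, y, hxy, hcode, rfl⟩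
    exact (blockGraph_adj_of_eq hxy).2 (blockAdj_of_blockCode _ _ _ hcode)
  -- every edge of the code in a block is realized in `X`
  have hreal : ∀ (i : Fin p ⊕ Fin r) (a b : Fin 5), blockCode i.isLeft a b →
      ∃ e ∈ blockCodeSet f, ∀ x, x ∈ e ↔ OnBlockEdge (f x) i a b := by
    intro i a b hab
    have hadj := blockAdj_of_blockCode _ _ _ hab
    obtain ⟨x, hx⟩ := (hrange (i, a)).2 (blockVertex_of_blockAdj _ _ _ (blockAdj_symm _ _ _ hadj))
    obtain ⟨y, hy⟩ := (hrange (i, b)).2 (blockVertex_of_blockAdj _ _ _ hadj)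
    refine ⟨s(x, y), ⟨x, y, by rw [hx, hy], by rw [hx, hy]; exact hab, rfl⟩, fun z => ?_⟩
    rw [Sym2.mem_iff, ← hf.eq_iff, ← hf.eq_iff (b := y), hx, hy, Prod.ext_iff, Prod.ext_iff]
    exact and_or_left.symm
  refine ⟨hsub, ?_, ?_⟩
  · intro e he
    induction e with | _ x y
    obtain ⟨a, b, hab, hon⟩ := exists_onBlockEdge he
    obtain ⟨c, hc, hmem⟩ := hreal _ a b hab
    exact ⟨c, (mem_closedEdgeNbhd_inter hsub c).2
      ⟨hc, hon.imp (fun h => (hmem x).2 h) fun h => (hmem y).2 h⟩⟩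
  · intro e he e' he' hne h
    induction e with | _ x y
    induction e' with | _ x' y'
    refine hne (Sym2.eq_iff.2 ?_)
    refine (blockGraph_separated he he' fun i a b hab => ?_).imp
      (fun h => ⟨hf h.1, hf h.2⟩) fun h => ⟨hf h.1, hf h.2⟩
    obtain ⟨c, hc, hmem⟩ := hreal _ a b hab
    rw [Set.ext_iff] at h
    have := h c
    rw [mem_closedEdgeNbhd_inter hsub, mem_closedEdgeNbhd_inter hsub] at this
    simpa [hc, hmem] using this

theorem ncard_blockCodeSet_le (hf : Function.Injective f) :
    (blockCodeSet f).ncard ≤ 3 * p + r := by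
  let g : (Fin p × Fin 3) ⊕ Fin r → Sym2 ((Fin p ⊕ Fin r) × Fin 5) :=
    Sum.elim (fun j => s((Sum.inl j.1, j.2.castSucc.castSucc), (Sum.inl j.1, j.2.succ.castSucc)))
      fun i => s((Sum.inr i, 0), (Sum.inr i, 1))
  have hsub : Sym2.map f '' blockCodeSet f ⊆ Set.range g := by
    rintro _ ⟨_, ⟨x, y, hxy, hcode, rfl⟩, rfl⟩
    rw [Sym2.map_mk]
    generalize f x = z at *
    generalize f y = w at *
    obtain ⟨i, s⟩ := z
    obtain ⟨j, t⟩ := w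
    obtain rfl : i = j := hxy
    rcases i with i | i
    · obtain ⟨m, ⟨rfl, rfl⟩ | ⟨rfl, rfl⟩⟩ := exists_chain_of_blockCode_true s t hcode
      · exact ⟨Sum.inl (i, m), rfl⟩
      · exact ⟨Sum.inl (i, m), Sym2.eq_swap⟩
    · obtain ⟨rfl, rfl⟩ | ⟨rfl, rfl⟩ := eq_of_blockCode_false s t hcode
      · exact ⟨Sum.inr i, rfl⟩
      · exact ⟨Sum.inr i, Sym2.eq_swap⟩
  have h := Set.ncard_le_ncard hsub (Set.finite_range g)
  rw [Set.ncard_image_of_injective _ (Sym2.map.injective hf)] at h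
  refine h.trans ?_
  rw [← Set.image_univ]
  refine (Set.ncard_image_le Set.finite_univ).trans ?_
  rw [Set.ncard_univ, Nat.card_eq_fintype_card]
  simp [mul_comm]

theorem connected_comap_blockGraph (hpr : 0 < p + r) (hf : Function.Injective f)
    (hrange : ∀ z, (∃ x, f x = z) ↔ blockVertex z.1.isLeft z.2) :
    ((blockGraph p r).comap f).Connected := by
  have hbase : ∀ i : Fin p ⊕ Fin r, ∃ x, f x = (i, 0) := fun i =>
    (hrange _).2 (by cases i <;> rfl)
  have hcore : ∀ i : Fin p ⊕ Fin r, blockCore i.isLeft 0 := by rintro (i | i) <;> rfl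
  have hzero : ∀ x y, f y = ((f x).1, 0) → ((blockGraph p r).comap f).Reachable x y := by
    intro x y hy
    have hxy : (f x).1 = (f y).1 := by rw [hy]
    rcases exists_blockAdj_zero _ _ ((hrange (f x)).1 ⟨x, rfl⟩) with h | h | ⟨h, h'⟩
    · rw [hf (show f x = f y by rw [hy]; exact Prod.ext rfl h)]
    · refine SimpleGraph.Adj.reachable ((blockGraph_adj_of_eq hxy).2 ?_)
      rwa [hy]
    · obtain ⟨w, hw⟩ := (hrange ((f x).1, 1)).2 (blockVertex_of_blockAdj _ _ _ h)
      have h1 : ((blockGraph p r).comap f).Adj x w := by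
        refine (blockGraph_adj_of_eq (by rw [hw])).2 ?_
        rwa [hw]
      have h2 : ((blockGraph p r).comap f).Adj w y := by
        refine (blockGraph_adj_of_eq (by rw [hw, hy])).2 ?_
        rwa [hw, hy]
      exact h1.reachable.trans h2.reachable
  have hpre : ((blockGraph p r).comap f).Preconnected := by
    intro x x'
    obtain ⟨y, hy⟩ := hbase (f x).1
    obtain ⟨y', hy'⟩ := hbase (f x').1
    refine (hzero x y hy).trans (SimpleGraph.Reachable.trans ?_ (hzero x' y' hy').symm)
    by_cases h : (f x).1 = (f x').1
    · rw [hf (show f y = f y' by rw [hy, hy', h])]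
    · refine SimpleGraph.Adj.reachable ((blockGraph_adj_of_ne (by rwa [hy, hy'])).2 ?_)
      rw [hy, hy']
      exact ⟨hcore _, hcore _⟩
  have hne : Nonempty X := by
    rcases Nat.eq_zero_or_pos p with h | h
    · obtain ⟨x, -⟩ := hbase (Sum.inr ⟨0, by omega⟩)
      exact ⟨x⟩
    · obtain ⟨x, -⟩ := hbase (Sum.inl ⟨0, h⟩)
      exact ⟨x⟩
  exact ⟨hpre⟩

theorem ncard_edgeSet_comap_blockGraph [Fintype X] (hf : Function.Injective f)
    (hrange : ∀ z, (∃ x, f x = z) ↔ blockVertex z.1.isLeft z.2) :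
    ((blockGraph p r).comap f).edgeSet.ncard = (4 * p + r).choose 2 + r := by
  have hadj : ∀ x w, (blockGraph p r).Adj (f x) w ↔
      ∃ y, f y = w ∧ ((blockGraph p r).comap f).Adj x y := by
    intro x w
    constructor
    · intro h
      obtain ⟨y, rfl⟩ := (hrange w).2 (blockVertex_of_adj h)
      exact ⟨y, rfl, h⟩
    · rintro ⟨y, rfl, h⟩
      exact h
  have hsum : ∑ x, ((blockGraph p r).comap f).degree x = ∑ z, (blockGraph p r).degree z := by
    refine Finset.sum_of_injOn f hf.injOn (fun _ _ => Finset.mem_univ _) ?_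
      fun x _ => degree_of_injective hf hadj x
    intro z _ hz
    by_contra h
    obtain ⟨w, hw⟩ := exists_adj_of_degree_pos (Nat.pos_of_ne_zero h)
    obtain ⟨x, rfl⟩ := (hrange z).2 (blockVertex_of_adj hw.symm)
    exact hz ⟨x, Finset.mem_coe.2 (Finset.mem_univ x), rfl⟩
  rw [sum_degree_blockGraph, SimpleGraph.sum_degrees_eq_twice_card_edges] at hsum
  rw [← SimpleGraph.coe_edgeFinset, Set.ncard_coe_finset]
  omega

/-- The bound is attained by `blockGraph (k / 3) (k % 3)`, restricted to its actual vertices. No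
smaller code is possible in a graph with `edgeBound k` edges, since `edgeBound` is strictly
monotone. -/
theorem exists_extremal {k : ℕ} (hk : 1 ≤ k) :
    ∃ (n : ℕ) (G : SimpleGraph (Fin n)) (C : Set (Sym2 (Fin n))),
      G.Connected ∧ PendantFree G ∧ IsEdgeIdentifyingCode G C ∧ C.ncard = k ∧
        edgeIdentifyingCodeNumber G = k ∧ G.edgeSet.ncard = edgeBound k := by
  obtain ⟨p, r, hr, rfl⟩ : ∃ p r, r < 3 ∧ k = 3 * p + r :=
    ⟨k / 3, k % 3, Nat.mod_lt _ (by norm_num), (Nat.div_add_mod k 3).symm⟩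
  let e := (Fintype.equivFin
    {z : (Fin p ⊕ Fin r) × Fin 5 // blockVertex z.1.isLeft z.2 = true}).symm
  let f := fun x => (e x).1
  have hf : Function.Injective f := Subtype.val_injective.comp e.injective
  have hrange : ∀ z, (∃ x, f x = z) ↔ blockVertex z.1.isLeft z.2 := by
    intro z
    constructor
    · rintro ⟨x, rfl⟩
      exact (e x).2
    · intro hz
      obtain ⟨x, hx⟩ := e.surjective ⟨z, hz⟩
      exact ⟨x, congrArg Subtype.val hx⟩
  have hC := isEdgeIdentifyingCode_blockCodeSet hf hrange
  have hE : ((blockGraph p r).comap f).edgeSet.ncard = edgeBound (3 * p + r) := by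
    rw [edgeBound_eq p r hr, ncard_edgeSet_comap_blockGraph hf hrange]
  have hlower : ∀ D, IsEdgeIdentifyingCode ((blockGraph p r).comap f) D → 3 * p + r ≤ D.ncard :=
    fun D hD => edgeBound_strictMono.le_iff_le.1 (hE ▸ hD.ncard_edgeSet_le.1)
  have hcard := le_antisymm (ncard_blockCodeSet_le hf) (hlower _ hC)
  refine ⟨_, (blockGraph p r).comap f, blockCodeSet f,
    connected_comap_blockGraph (by omega) hf hrange, hC.pendantFree, hC, hcard, ?_, hE⟩
  refine le_antisymm (Nat.sInf_le ⟨_, hC, hcard⟩) ?_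
  refine le_csInf ⟨_, _, hC, hcard⟩ ?_
  rintro n ⟨D, hD, rfl⟩
  exact hlower D hD

end Tight

end EdgeCode

open EdgeCode in
theorem theorem3p2 (k : ℕ) :
    -- the bound, and the structure of the code in extremal graphs
    (∀ (V : Type*) [Finite V] (G : SimpleGraph V) (C : Set (Sym2 V)),
      PendantFree G → IsEdgeIdentifyingCode G C → C.ncard = k →
        G.edgeSet.ncard ≤ edgeBound k ∧
        (4 ≤ k → G.edgeSet.ncard = edgeBound k →
          (k % 3 = 0 → exceptionalComponents C = ∅) ∧
          (k % 3 = 1 → ∃ c, exceptionalComponents C = {c} ∧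
            (IsPathComponent c 2 ∨ IsPathComponent c 5)) ∧
          (k % 3 = 2 →
            (∃ c, exceptionalComponents C = {c} ∧ IsPathComponent c 6) ∨
            (∃ c d, c ≠ d ∧ exceptionalComponents C = {c, d} ∧
              (IsPathComponent c 2 ∨ IsPathComponent c 5) ∧
              (IsPathComponent d 2 ∨ IsPathComponent d 5))))) ∧
    -- the bound is attained for every size of a code
    (1 ≤ k → ∃ (n : ℕ) (G : SimpleGraph (Fin n)) (C : Set (Sym2 (Fin n))),
      G.Connected ∧ PendantFree G ∧ IsEdgeIdentifyingCode G C ∧ C.ncard = k ∧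
        edgeIdentifyingCodeNumber G = k ∧ G.edgeSet.ncard = edgeBound k) := by
  refine ⟨?_, exists_extremal⟩
  rintro V _ G C - hC rfl
  have := Fintype.ofFinite V
  exact ⟨hC.ncard_edgeSet_le.1, fun hk hE => hC.exceptionalComponents hk hE⟩
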